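/- Let $\lambda,\mu>0$ and $\rho=\lambda/\mu$. Let $G=\{G(t),t\ge 0\}$ be the continuous time Markov chain on the set of finite rooted trees that starts at time $0$ from the tree consisting of the root $v_0$ only and has the following transitions: at each vertex, a new edge leading to a new leaf is attached at rate $\lambda$; each leaf other than the root is deleted at rate $\mu$. Let $N(t)$ be the volume (number of vertices) of $G(t)$. **Theorem.** Suppose that $\rho\le e^{-1}$, and let $r$ be the smallest root of the equation $re^{-r}=\rho$. Then $G$ does not explode, and $N(t)$ converges in distribution, as $t\to\infty$, to a random variable $N$ (the stationary volume) with $$\mathbb P\{N=k\}=\frac1r\,\frac{k^{k-1}}{k!}\,\rho^k,\qquad k\ge 1,$$ and with mean $$\mathbb E N=\frac1{1-r},$$ which is to be read as $\mathbb E N=\infty$ when $r=1$, that is, when $\rho=e^{-1}$. -/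

import Mathlib

open MeasureTheory Filter Topology
open scoped NNReal ENNReal

/-- Finite rooted trees: a tree is its root together with the list of the subtrees that hang
from the root. Siblings are listed from the youngest to the oldest. -/
inductive RTree : Type
  | node (children : List RTree) : RTree

namespace RTree

/-- The tree that consists of the root alone. -/
def single : RTree := node []

mutual
/-- The volume of a tree: its number of vertices. -/
def volume : RTree → ℕ
  | node cs => 1 + forestVolume cs
/-- The number of vertices of a list of trees. -/
def forestVolume : List RTree → ℕ
  | [] => 0
  | t :: ts => volume t + forestVolume ts
end

mutual
/-- The trees that arise by attaching one new leaf to one vertex of the given tree, with one list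
entry for each vertex (the root included). The new leaf is the youngest child of its parent. -/
def grown : RTree → List RTree
  | node cs => node (single :: cs) :: (forestGrown cs).map node
/-- The lists of trees that arise by attaching one new leaf to one vertex of the given list of
trees, with one list entry for each vertex. -/
def forestGrown : List RTree → List (List RTree)
  | [] => []
  | t :: ts => (grown t).map (fun t' => t' :: ts) ++ (forestGrown ts).map (fun ts' => t :: ts')
end

mutual
/-- The trees that arise by deleting one leaf other than the root from the given tree, with one
list entry for each such leaf. -/
def pruned : RTree → List RTree
  | node cs => (forestPruned cs).map node
/-- The lists of trees that arise by deleting one leaf from the given list of trees, where a tree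
that consists of its root alone disappears, with one list entry for each leaf. -/
def forestPruned : List RTree → List (List RTree)
  | [] => []
  | node [] :: ts => ts :: (forestPruned ts).map (fun ts' => single :: ts')
  | node (c :: cs) :: ts =>
      (pruned (node (c :: cs))).map (fun t' => t' :: ts) ++
        (forestPruned ts).map (fun ts' => node (c :: cs) :: ts')
end

/-- All sets of trees are measurable. -/
instance : MeasurableSpace RTree := ⊤

end RTree

/-- The total rate at which the chain leaves the tree `x`: every vertex produces a new leaf at rate
`lam`, and every leaf other than the root is deleted at rate `mu`. -/
def exitRate (lam mu : ℝ) (x : RTree) : ℝ :=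
  lam * (x.grown.length : ℝ) + mu * (x.pruned.length : ℝ)

open Classical in
/-- The probability that the chain with birth rate `lam` and deletion rate `mu`, started at the
tree `x`, is at the tree `y` at time `t` after fewer than `n` jumps. The recursion conditions on the
time `s` of the first jump and on the tree `z` reached by it. -/
noncomputable def transitionUpTo (lam mu : ℝ) : ℕ → ℝ → RTree → RTree → ℝ≥0∞
  | 0, _, _, _ => 0
  | n + 1, t, x, y =>
      (if x = y then ENNReal.ofReal (Real.exp (-(exitRate lam mu x * t))) else 0) +
        ∫⁻ s in Set.Icc (0 : ℝ) t, ENNReal.ofReal (Real.exp (-(exitRate lam mu x * s))) *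
          (ENNReal.ofReal lam * (x.grown.map fun z => transitionUpTo lam mu n (t - s) z y).sum +
            ENNReal.ofReal mu * (x.pruned.map fun z => transitionUpTo lam mu n (t - s) z y).sum)

/-- The transition function of the continuous time Markov chain with birth rate `lam` and deletion
rate `mu`: the probability of being at `y` at time `t` when started at `x`. This is Feller's
construction from the jump rates, the minimal nonnegative solution of the backward equation. -/
noncomputable def transition (lam mu t : ℝ) (x y : RTree) : ℝ≥0∞ :=
  ⨆ n, transitionUpTo lam mu n t x y

/-- `G` is the random tree process with birth rate `lam` and deletion rate `mu`: a continuous time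
Markov chain on the finite rooted trees that starts at the tree with a single vertex and has the
transition function `transition lam mu`. -/
structure IsTreeProcess (lam mu : ℝ) {Ω : Type*} [MeasurableSpace Ω] (P : Measure Ω)
    (G : ℝ≥0 → Ω → RTree) : Prop where
  measurable : ∀ t, Measurable (G t)
  initial : ∀ᵐ ω ∂P, G 0 ω = RTree.single
  markov : ∀ (n : ℕ) (t : ℕ → ℝ≥0) (x : ℕ → RTree), Monotone t →
    P {ω | ∀ i ≤ n + 1, G (t i) ω = x i} =
      P {ω | ∀ i ≤ n, G (t i) ω = x i} *
        transition lam mu ((t (n + 1) : ℝ) - (t n : ℝ)) (x n) (x (n + 1))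

-- Write `ρ = lam / mu`. On plane trees the chain is not reversible, because a new leaf always
-- becomes the youngest child whereas any leaf may be deleted. It becomes reversible once the order
-- of siblings is ignored. Give a tree the weight `∏ ρ / n_v!`, where `n_v` is the number of
-- children of the vertex `v`. If a new leaf takes a uniform place among its siblings, the factor `1
-- / (n + 1)` accounts for the change from `n!` to `(n + 1)!`, and detailed balance with deletion
-- holds exactly (`detailed_balance`). On functions that do not see the order of siblings, uniform
-- insertion and youngest-first insertion have the same effect (`sum_grown_eq_tsum`). The volume is
-- such a function, so it suffices to work with invariant functions throughout.
--
-- Explosion is excluded by the Lyapunov function `volume` (`tail_le`, `semigroup_one`). Convergence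
-- is an `ℓ²` argument for reversible semigroups `P_t`: `⟨f, P_t f⟩` decreases in `t`, and `‖P_s f -
-- P_t f‖² = ⟨f, P_{2s} f⟩ + ⟨f, P_{2t} f⟩ - 2 ⟨f, P_{s+t} f⟩`, so `P_t f` is Cauchy. The limit is
-- fixed by `P_1`, its Dirichlet form vanishes, hence it is constant, and conservation of mass
-- identifies the constant (`tendsto_semigroup`).
--
-- It remains to compute with the weights. Cutting a tree at its root gives `Z = ρ exp Z` for the
-- total weight `Z`, and induction on the volume shows that `Z` lies below every supersolution
-- (`totalWeight_le`). So `Z` is the smallest root `r`, and `Z ≤ 1` because `ρ ≤ exp (-1)`. The same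
-- decomposition gives `M = Z + Z M` for the volume-weighted sum, whence the mean `M / Z = 1 / (1 -
-- Z)`. The weight of all trees with `k` vertices is `k ^ (k - 1) / k! * ρ ^ k`, by an induction
-- over forests (`forestMass_eq`).

/-! ### Jump chains with exit rates `q` and jump rates `k` -/

namespace JumpChain

variable {S : Type*}

/-- The probability that the chain stays at `x` for the time `t`. -/
noncomputable def hold (q : S → ℝ) (t : ℝ) (x : S) : ℝ≥0∞ :=
  ENNReal.ofReal (Real.exp (-(q x * t)))

/-- The operator on functions that is given by the kernel of the jump rates. -/
noncomputable def jumpOp (k : S → S → ℝ≥0∞) (f : S → ℝ≥0∞) (x : S) : ℝ≥0∞ :=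
  ∑' y, k x y * f y

/-- The expectation of `f` at time `t` on the event that there are exactly `n` jumps up to then. -/
noncomputable def jumps (q : S → ℝ) (k : S → S → ℝ≥0∞) : ℕ → (S → ℝ≥0∞) → ℝ → S → ℝ≥0∞
  | 0, f, t, x => hold q t x * f x
  | n + 1, f, t, x =>
      ∫⁻ s in Set.Icc (0 : ℝ) t, hold q s x * jumpOp k (jumps q k n f (t - s)) x

/-- The expectation of `f` at time `t`. -/
noncomputable def semigroup (q : S → ℝ) (k : S → S → ℝ≥0∞) (t : ℝ) (f : S → ℝ≥0∞) (x : S) :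
    ℝ≥0∞ :=
  ∑' n, jumps q k n f t x

/-- The probability of at least `n` jumps up to time `t`. -/
noncomputable def tail (q : S → ℝ) (k : S → S → ℝ≥0∞) : ℕ → ℝ → S → ℝ≥0∞
  | 0, _, _ => 1
  | n + 1, t, x => ∫⁻ s in Set.Icc (0 : ℝ) t, hold q s x * jumpOp k (tail q k n (t - s)) x

variable {q : S → ℝ} {k : S → S → ℝ≥0∞}

lemma measurable_hold (x : S) : Measurable fun t => hold q t x := by
  unfold hold; fun_prop

lemma hold_zero_lt (t : ℝ) (x : S) : 0 < hold q t x :=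
  ENNReal.ofReal_pos.2 (Real.exp_pos _)

lemma hold_add (s t : ℝ) (x : S) : hold q (s + t) x = hold q s x * hold q t x := by
  unfold hold
  rw [← ENNReal.ofReal_mul (Real.exp_pos _).le, ← Real.exp_add]
  ring_nf

-- Integrals over time intervals.

lemma measurable_setLIntegral_Icc {α : Type*} [MeasurableSpace α] {F : α → ℝ → ℝ≥0∞}
    (hF : Measurable (Function.uncurry F)) {τ : α → ℝ} (hτ : Measurable τ) :
    Measurable fun a => ∫⁻ s in Set.Icc (0 : ℝ) (τ a), F a s := by
  have h : ∀ a, ∫⁻ s in Set.Icc (0 : ℝ) (τ a), F a s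
      = ∫⁻ s, {p : α × ℝ | 0 ≤ p.2 ∧ p.2 ≤ τ p.1}.indicator (Function.uncurry F) (a, s) := by
    intro a
    rw [← lintegral_indicator measurableSet_Icc]
    rfl
  simp_rw [h]
  refine Measurable.lintegral_prod_right' (hF.indicator ?_)
  exact (measurableSet_le measurable_const measurable_snd).inter
    (measurableSet_le measurable_snd (hτ.comp measurable_fst))

lemma setLIntegral_Icc_reflect (t : ℝ) (F : ℝ → ℝ≥0∞) :
    ∫⁻ s in Set.Icc (0 : ℝ) t, F (t - s) = ∫⁻ s in Set.Icc (0 : ℝ) t, F s := by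
  rw [← lintegral_indicator measurableSet_Icc, ← lintegral_indicator measurableSet_Icc,
    ← lintegral_sub_left_eq_self (fun s => (Set.Icc (0 : ℝ) t).indicator F s) t]
  refine lintegral_congr fun s => ?_
  by_cases h : s ∈ Set.Icc 0 t
  · have h' : t - s ∈ Set.Icc 0 t := ⟨by linarith [h.2], by linarith [h.1]⟩
    simp [h, h']
  · have h' : t - s ∉ Set.Icc 0 t := fun h' => h ⟨by linarith [h'.2], by linarith [h'.1]⟩
    rw [Set.indicator_of_notMem h, Set.indicator_of_notMem h']

/-- Both sides integrate over the triangle `0 ≤ s`, `0 ≤ u`, `s + u ≤ t`; substitute `v = s + u` and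
apply Tonelli. -/
lemma setLIntegral_Icc_triangle (t : ℝ) {F : ℝ → ℝ → ℝ≥0∞}
    (hF : Measurable (Function.uncurry F)) :
    ∫⁻ s in Set.Icc (0 : ℝ) t, ∫⁻ u in Set.Icc (0 : ℝ) (t - s), F s u
      = ∫⁻ v in Set.Icc (0 : ℝ) t, ∫⁻ s in Set.Icc (0 : ℝ) v, F s (v - s) := by
  set A : Set (ℝ × ℝ) := {p | 0 ≤ p.1 ∧ 0 ≤ p.2 ∧ p.1 + p.2 ≤ t} with hA
  have hAm : MeasurableSet A :=
    (measurableSet_le measurable_const measurable_fst).inter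
      ((measurableSet_le measurable_const measurable_snd).inter
        (measurableSet_le (measurable_fst.add measurable_snd) measurable_const))
  set G : ℝ × ℝ → ℝ≥0∞ := A.indicator (Function.uncurry F) with hG
  have hGm : Measurable G := hF.indicator hAm
  have h1 : ∫⁻ s in Set.Icc (0 : ℝ) t, ∫⁻ u in Set.Icc (0 : ℝ) (t - s), F s u
      = ∫⁻ s, ∫⁻ u, G (s, u) := by
    rw [← lintegral_indicator measurableSet_Icc]
    refine lintegral_congr fun s => ?_
    by_cases hs : s ∈ Set.Icc 0 t
    · rw [Set.indicator_of_mem hs, ← lintegral_indicator measurableSet_Icc]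
      refine lintegral_congr fun u => ?_
      simp only [hG, hA, Set.indicator, Set.mem_Icc, Set.mem_ofPred_eq, hs.1, true_and]
      simp only [le_sub_iff_add_le', Function.uncurry]
    · rw [Set.indicator_of_notMem hs, eq_comm]
      rw [lintegral_eq_zero_of_ae_eq_zero]
      refine Eventually.of_forall fun u => ?_
      have : (s, u) ∉ A := fun h => hs ⟨h.1, by linarith [h.2.1, h.2.2]⟩
      simp [hG, this]
  have h2 : ∫⁻ v in Set.Icc (0 : ℝ) t, ∫⁻ s in Set.Icc (0 : ℝ) v, F s (v - s)
      = ∫⁻ v, ∫⁻ s, G (s, v - s) := by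
    rw [← lintegral_indicator measurableSet_Icc]
    refine lintegral_congr fun v => ?_
    by_cases hv : v ∈ Set.Icc 0 t
    · rw [Set.indicator_of_mem hv, ← lintegral_indicator measurableSet_Icc]
      refine lintegral_congr fun s => ?_
      by_cases hs : s ∈ Set.Icc 0 v
      · have : (s, v - s) ∈ A := ⟨hs.1, by linarith [hs.2], by linarith [hv.2]⟩
        simp [hG, this, hs]
      · have : (s, v - s) ∉ A := fun h => hs ⟨h.1, by linarith [h.2.1]⟩
        rw [hG, Set.indicator_of_notMem hs, Set.indicator_of_notMem this]
    · rw [Set.indicator_of_notMem hv, eq_comm]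
      rw [lintegral_eq_zero_of_ae_eq_zero]
      refine Eventually.of_forall fun s => ?_
      have : (s, v - s) ∉ A := fun h => hv ⟨by linarith [h.1, h.2.1], by linarith [h.2.2]⟩
      simp [hG, this]
  have hGm' : Measurable (Function.uncurry fun v s => G (s, v - s)) :=
    hGm.comp (measurable_snd.prodMk (measurable_fst.sub measurable_snd))
  rw [h1, h2, lintegral_lintegral_swap hGm'.aemeasurable]
  refine lintegral_congr fun s => ?_
  exact (lintegral_sub_right_eq_self (fun v => G (s, v)) s).symm

-- Linearity, monotonicity and invariance of the jump operators.

lemma jumpOp_const_mul (c : ℝ≥0∞) (f : S → ℝ≥0∞) (x : S) :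
    jumpOp k (fun y => c * f y) x = c * jumpOp k f x := by
  unfold jumpOp
  rw [← ENNReal.tsum_mul_left]
  exact tsum_congr fun y => by ring

lemma jumpOp_tsum {ι : Type*} (f : ι → S → ℝ≥0∞) (x : S) :
    jumpOp k (fun y => ∑' i, f i y) x = ∑' i, jumpOp k (f i) x := by
  unfold jumpOp
  simp_rw [← ENNReal.tsum_mul_left]
  exact ENNReal.tsum_comm

lemma jumpOp_add (f g : S → ℝ≥0∞) (x : S) :
    jumpOp k (fun y => f y + g y) x = jumpOp k f x + jumpOp k g x := by
  unfold jumpOp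
  rw [← ENNReal.tsum_add]
  exact tsum_congr fun y => mul_add _ _ _

lemma jumpOp_sum {ι : Type*} (s : Finset ι) (f : ι → S → ℝ≥0∞) (x : S) :
    jumpOp k (fun y => ∑ i ∈ s, f i y) x = ∑ i ∈ s, jumpOp k (f i) x := by
  unfold jumpOp
  simp_rw [Finset.mul_sum]
  exact Summable.tsum_finsetSum fun _ _ => ENNReal.summable

lemma jumpOp_mono {f g : S → ℝ≥0∞} (h : ∀ y, f y ≤ g y) (x : S) : jumpOp k f x ≤ jumpOp k g x :=
  ENNReal.tsum_le_tsum fun y => by gcongr; exact h y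

lemma jumps_mono (n : ℕ) {f g : S → ℝ≥0∞} (h : ∀ x, f x ≤ g x) (t : ℝ) (x : S) :
    jumps q k n f t x ≤ jumps q k n g t x := by
  induction n generalizing t x with
  | zero => simp only [jumps]; gcongr; exact h x
  | succ n ih =>
    simp only [jumps]
    refine lintegral_mono fun s => ?_
    gcongr
    exact jumpOp_mono (fun y => ih _ y) x

/-- The pairing of functions with respect to the weights `π`. -/
noncomputable def pairing (π : S → ℝ≥0∞) (g f : S → ℝ≥0∞) : ℝ≥0∞ := ∑' x, π x * (g x * f x)

/-- The functions that do not separate related points. -/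
def Invariant {β : Type*} (r : S → S → Prop) (f : S → β) : Prop := ∀ x y, r x y → f x = f y

variable {r : S → S → Prop} {π : S → ℝ≥0∞}

lemma pairing_comm (g f : S → ℝ≥0∞) : pairing π g f = pairing π f g :=
  tsum_congr fun x => by rw [mul_comm (g x)]

lemma Invariant.hold (hq : Invariant r q) (t : ℝ) : Invariant r (hold q t) :=
  fun x y h => by simp only [JumpChain.hold, hq x y h]

lemma Invariant.mul {f g : S → ℝ≥0∞} (hf : Invariant r f) (hg : Invariant r g) :
    Invariant r fun x => f x * g x := fun x y h => by simp only [hf x y h, hg x y h]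

lemma Invariant.jumps (hq : Invariant r q)
    (hk : ∀ f, Invariant r f → Invariant r (jumpOp k f)) (n : ℕ) {f : S → ℝ≥0∞}
    (hf : Invariant r f) (t : ℝ) : Invariant r (jumps q k n f t) := by
  induction n generalizing t with
  | zero => exact (hq.hold t).mul hf
  | succ n ih =>
    intro x y h
    refine lintegral_congr fun s => ?_
    rw [hq.hold s x y h, hk _ (ih (t - s)) x y h]

lemma Invariant.semigroup (hq : Invariant r q)
    (hk : ∀ f, Invariant r f → Invariant r (jumpOp k f)) {f : S → ℝ≥0∞}
    (hf : Invariant r f) (t : ℝ) : Invariant r (semigroup q k t f) :=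
  fun x y h => tsum_congr fun n => Invariant.jumps hq hk n hf t x y h

lemma semigroup_mono {f g : S → ℝ≥0∞} (h : ∀ x, f x ≤ g x) (t : ℝ) (x : S) :
    semigroup q k t f x ≤ semigroup q k t g x :=
  ENNReal.tsum_le_tsum fun n => jumps_mono n h t x

/-- The factor `a` stands outside the integral so that the rate `a = 0` is covered. -/
lemma lintegral_exp_neg_mul {a t : ℝ} (ha : 0 ≤ a) (ht : 0 ≤ t) :
    ENNReal.ofReal a * ∫⁻ s in Set.Icc 0 t, ENNReal.ofReal (Real.exp (-(a * s)))
      = ENNReal.ofReal (1 - Real.exp (-(a * t))) := by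
  rcases ha.eq_or_lt with rfl | ha
  · simp
  have hc : Continuous fun s => a * Real.exp (-(a * s)) := by fun_prop
  rw [← lintegral_const_mul _ (by fun_prop)]
  simp_rw [← ENNReal.ofReal_mul ha.le]
  rw [setLIntegral_congr Ioc_ae_eq_Icc.symm, ← ofReal_integral_eq_lintegral_ofReal
    (hc.integrableOn_Ioc) (Eventually.of_forall fun s => by positivity),
    ← intervalIntegral.integral_of_le ht,
    intervalIntegral.integral_eq_sub_of_hasDerivAt (f := fun s => -Real.exp (-(a * s)))
      (fun s _ => ?_) (hc.intervalIntegrable _ _)]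
  · simp; ring_nf
  · have := (((hasDerivAt_id s).const_mul a).neg.exp).neg
    simpa [mul_comm, Pi.neg_def] using this

open Classical in
/-- The transition probabilities. -/
noncomputable def prob (q : S → ℝ) (k : S → S → ℝ≥0∞) (t : ℝ) (x y : S) : ℝ≥0∞ :=
  semigroup q k t (fun z => if z = y then 1 else 0) x

/-- A single jump from `x` to `y` at any time before `t`, with no further jump, already has positive
probability. -/
lemma prob_pos {x y : S} (h : k x y ≠ 0) {t : ℝ} (ht : 0 < t) (hq : ∀ x, 0 ≤ q x) :
    0 < prob q k t x y := by
  classical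
  refine lt_of_lt_of_le ?_ (ENNReal.le_tsum 1)
  have hle : ∀ s ∈ Set.Icc 0 t, hold q t x * (k x y * hold q t y) ≤
      hold q s x * jumpOp k (jumps q k 0 (fun z => if z = y then 1 else 0) (t - s)) x := by
    intro s hs
    gcongr
    · unfold hold
      gcongr
      · exact hq x
      · exact hs.2
    · refine le_trans ?_ (ENNReal.le_tsum y)
      simp only [jumps, if_true, mul_one]
      gcongr
      unfold hold
      gcongr
      · exact hq y
      · linarith [hs.1]
  calc 0 < hold q t x * (k x y * hold q t y) * ENNReal.ofReal t :=
        ENNReal.mul_pos (mul_ne_zero (hold_zero_lt t x).ne'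
          (mul_ne_zero h (hold_zero_lt t y).ne')) (by simpa using ht)
    _ = ∫⁻ _ in Set.Icc 0 t, hold q t x * (k x y * hold q t y) := by simp
    _ ≤ _ := setLIntegral_mono' measurableSet_Icc hle

-- Measurability in time and the forward recursion.

variable [Countable S]

lemma measurable_jumpOp {α : Type*} [MeasurableSpace α] {h : α → S → ℝ≥0∞}
    (hh : ∀ x, Measurable fun a => h a x) (x : S) : Measurable fun a => jumpOp k (h a) x :=
  Measurable.tsum fun y => (hh y).const_mul _

lemma jumpOp_lintegral {μ : Measure ℝ} {h : ℝ → S → ℝ≥0∞}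
    (hh : ∀ x, Measurable fun a => h a x) (x : S) :
    jumpOp k (fun y => ∫⁻ s, h s y ∂μ) x = ∫⁻ s, jumpOp k (h s) x ∂μ := by
  unfold jumpOp
  rw [lintegral_tsum fun y => ((hh y).const_mul _).aemeasurable]
  exact tsum_congr fun y => (lintegral_const_mul _ (hh y)).symm

/-- Function and time both depend on a parameter, since the forward recursion feeds in
time-dependent functions. The parameter space is quantified inside the induction because each step
enlarges it to `α × ℝ`. -/
lemma measurable_jumps (n : ℕ) : ∀ {α : Type} [MeasurableSpace α] {h : α → S → ℝ≥0∞}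
    (_ : ∀ x, Measurable fun a => h a x) {τ : α → ℝ} (_ : Measurable τ) (x : S),
    Measurable fun a => jumps q k n (h a) (τ a) x := by
  induction n with
  | zero => exact fun hh _ hτ x => ((measurable_hold x).comp hτ).mul (hh x)
  | succ n ih =>
    intro α _ h hh τ hτ x
    refine measurable_setLIntegral_Icc (F := fun a s =>
      hold q s x * jumpOp k (jumps q k n (h a) (τ a - s)) x) ?_ hτ
    exact ((measurable_hold x).comp measurable_snd).mul
      (measurable_jumpOp (h := fun p : α × ℝ => jumps q k n (h p.1) (τ p.1 - p.2)) (fun y =>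
        ih (h := fun p : α × ℝ => h p.1) (fun y => (hh y).comp measurable_fst)
          ((hτ.comp measurable_fst).sub measurable_snd) y) x)

lemma measurable_jumps_time (n : ℕ) (f : S → ℝ≥0∞) (x : S) :
    Measurable fun t => jumps q k n f t x :=
  measurable_jumps n (h := fun _ => f) (fun _ => measurable_const) measurable_id x

lemma measurable_jumps_sub (n : ℕ) (f : S → ℝ≥0∞) (t : ℝ) (x : S) :
    Measurable fun s => jumps q k n f (t - s) x :=
  (measurable_jumps_time n f x).comp (measurable_const.sub measurable_id)

lemma measurable_integrand (n : ℕ) (f : S → ℝ≥0∞) (t : ℝ) (x : S) :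
    Measurable fun s => hold q s x * jumpOp k (jumps q k n f (t - s)) x :=
  (measurable_hold x).mul (measurable_jumpOp (fun y => measurable_jumps_sub n f t y) x)

lemma jumps_tsum (n : ℕ) {ι : Type*} [Countable ι] (f : ι → S → ℝ≥0∞) (t : ℝ) (x : S) :
    jumps q k n (fun y => ∑' i, f i y) t x = ∑' i, jumps q k n (f i) t x := by
  induction n generalizing t x with
  | zero => simp only [jumps, ENNReal.tsum_mul_left]
  | succ n ih =>
    simp only [jumps]
    rw [← lintegral_tsum fun i => (measurable_integrand n (f i) t x).aemeasurable]
    refine lintegral_congr fun s => ?_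
    rw [ENNReal.tsum_mul_left, ← jumpOp_tsum]
    congr 2
    exact funext fun y => ih _ y

lemma jumps_const_mul (n : ℕ) (c : ℝ≥0∞) (f : S → ℝ≥0∞) (t : ℝ) (x : S) :
    jumps q k n (fun y => c * f y) t x = c * jumps q k n f t x := by
  induction n generalizing t x with
  | zero => simp only [jumps]; ring
  | succ n ih =>
    simp only [jumps]
    rw [← lintegral_const_mul _ (measurable_integrand n f t x)]
    refine lintegral_congr fun s => ?_
    rw [funext (ih (t - s)), jumpOp_const_mul]
    ring

/-- The forward recursion: condition on the time of the last jump. -/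
lemma jumps_succ_eq_forward (n : ℕ) (f : S → ℝ≥0∞) (t : ℝ) (x : S) :
    jumps q k (n + 1) f t x
      = ∫⁻ v in Set.Icc (0 : ℝ) t,
          jumps q k n (jumpOp k fun y => hold q (t - v) y * f y) v x := by
  induction n generalizing t x with
  -- With exactly one jump, the first and the last jump coincide.
  | zero => rfl
  | succ n ih =>
    have hm : ∀ y, Measurable fun v => jumpOp k (fun y => hold q (t - v) y * f y) y := fun y =>
      measurable_jumpOp (fun z => ((measurable_hold z).comp
        (measurable_const.sub measurable_id)).mul_const _) y
    have hJ : Measurable (Function.uncurry fun s u => hold q s x *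
        jumpOp k (jumps q k n (jumpOp k fun y => hold q (t - s - u) y * f y) u) x) := by
      refine ((measurable_hold x).comp measurable_fst).mul ?_
      refine measurable_jumpOp (h := fun p : ℝ × ℝ =>
        jumps q k n (jumpOp k fun y => hold q (t - p.1 - p.2) y * f y) p.2) (fun y => ?_) x
      refine measurable_jumps n (h := fun p : ℝ × ℝ =>
        jumpOp k fun y => hold q (t - p.1 - p.2) y * f y) (fun z => ?_) measurable_snd y
      have := (hm z).comp
        (measurable_fst.add measurable_snd : Measurable fun p : ℝ × ℝ => p.1 + p.2)
      simpa [Function.comp_def, sub_sub] using this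
    -- The first jump is at time `s` and the last at `v = s + u`; exchanging the integrals over the
    -- triangle brings `v` to the outside.
    calc jumps q k (n + 1 + 1) f t x
        = ∫⁻ s in Set.Icc (0 : ℝ) t, hold q s x * jumpOp k (jumps q k (n + 1) f (t - s)) x := rfl
      _ = ∫⁻ s in Set.Icc (0 : ℝ) t, ∫⁻ u in Set.Icc (0 : ℝ) (t - s), hold q s x *
            jumpOp k (jumps q k n (jumpOp k fun y => hold q (t - s - u) y * f y) u) x := by
          refine lintegral_congr fun s => ?_
          have hmu : ∀ y, Measurable fun u =>
              jumps q k n (jumpOp k fun y => hold q (t - s - u) y * f y) u y := fun y =>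
            measurable_jumps n (h := fun u => jumpOp k fun y => hold q (t - s - u) y * f y)
              (fun z => by
                have := (hm z).comp (measurable_const.add measurable_id : Measurable fun u => s + u)
                simpa [Function.comp_def, sub_sub] using this) measurable_id y
          rw [funext fun y => ih (t - s) y, jumpOp_lintegral hmu,
            lintegral_const_mul _ (measurable_jumpOp hmu x)]
      _ = ∫⁻ v in Set.Icc (0 : ℝ) t, ∫⁻ s in Set.Icc (0 : ℝ) v, hold q s x *
            jumpOp k (jumps q k n
              (jumpOp k fun y => hold q (t - s - (v - s)) y * f y) (v - s)) x :=
          setLIntegral_Icc_triangle t hJ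
      _ = _ := by
          refine lintegral_congr fun v => ?_
          simp only [sub_sub, add_sub_cancel]
          rfl

/-! ### Symmetry -/

lemma pairing_lintegral {μ : Measure ℝ} (g : S → ℝ≥0∞) {h : ℝ → S → ℝ≥0∞}
    (hh : ∀ x, Measurable fun a => h a x) :
    pairing π g (fun y => ∫⁻ s, h s y ∂μ) = ∫⁻ s, pairing π g (h s) ∂μ := by
  unfold pairing
  rw [lintegral_tsum fun y => (((hh y).const_mul _).const_mul _).aemeasurable]
  refine tsum_congr fun y => ?_
  rw [lintegral_const_mul _ ((hh y).const_mul _), lintegral_const_mul _ (hh y)]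

/-- Moving a path from `f` to `g` reverses time: the first-jump recursion for `f` turns into the
last-jump recursion for `g`. -/
lemma pairing_jumps (hq : Invariant r q)
    (hk : ∀ f, Invariant r f → Invariant r (jumpOp k f))
    (hsymm : ∀ f g, Invariant r f → Invariant r g →
      pairing π g (jumpOp k f) = pairing π (jumpOp k g) f)
    (n : ℕ) {f g : S → ℝ≥0∞} (hf : Invariant r f) (hg : Invariant r g) (t : ℝ) :
    pairing π g (jumps q k n f t) = pairing π (jumps q k n g t) f := by
  induction n generalizing f g t with
  | zero => exact tsum_congr fun x => by simp only [jumps]; ring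
  | succ n ih =>
    have hm : ∀ y, Measurable fun v => jumpOp k (fun y => hold q (t - v) y * g y) y := fun y =>
      measurable_jumpOp (fun z => ((measurable_hold z).comp
        (measurable_const.sub measurable_id)).mul_const _) y
    calc pairing π g (jumps q k (n + 1) f t)
        = ∫⁻ s in Set.Icc (0 : ℝ) t,
            pairing π g (fun x => hold q s x * jumpOp k (jumps q k n f (t - s)) x) :=
          pairing_lintegral g fun x => measurable_integrand n f t x
      _ = ∫⁻ s in Set.Icc (0 : ℝ) t,
            pairing π (jumps q k n (jumpOp k fun y => hold q s y * g y) (t - s)) f := by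
          refine lintegral_congr fun s => ?_
          rw [← ih hf (hk _ ((hq.hold s).mul hg)),
            ← hsymm _ _ (Invariant.jumps hq hk n hf _) ((hq.hold s).mul hg)]
          exact tsum_congr fun x => by simp only; ring
      _ = ∫⁻ v in Set.Icc (0 : ℝ) t,
            pairing π (jumps q k n (jumpOp k fun y => hold q (t - v) y * g y) v) f := by
          rw [← setLIntegral_Icc_reflect]
          simp only [sub_sub_cancel]
      _ = pairing π (jumps q k (n + 1) g t) f := by
          simp_rw [pairing_comm _ f]
          rw [show jumps q k (n + 1) g t = _ from funext fun x => jumps_succ_eq_forward n g t x]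
          exact (pairing_lintegral f fun x => measurable_jumps n (h := fun v =>
            jumpOp k fun y => hold q (t - v) y * g y) hm measurable_id x).symm

lemma pairing_semigroup (hq : Invariant r q)
    (hk : ∀ f, Invariant r f → Invariant r (jumpOp k f))
    (hsymm : ∀ f g, Invariant r f → Invariant r g →
      pairing π g (jumpOp k f) = pairing π (jumpOp k g) f)
    {f g : S → ℝ≥0∞} (hf : Invariant r f) (hg : Invariant r g) (t : ℝ) :
    pairing π g (semigroup q k t f) = pairing π (semigroup q k t g) f := by
  have h : ∀ a b : S → ℝ≥0∞, pairing π a (semigroup q k t b)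
      = ∑' n, pairing π a (jumps q k n b t) := fun a b => by
    unfold pairing semigroup
    simp_rw [← ENNReal.tsum_mul_left]
    exact ENNReal.tsum_comm
  rw [h, pairing_comm _ f, h]
  refine tsum_congr fun n => ?_
  rw [pairing_jumps hq hk hsymm n hf hg, pairing_comm]

/-! ### The semigroup property -/

/-- Here `p.1` counts the jumps up to time `s`. The first jump falls either after `s`, which is the
term `p.1 = 0`, or before `s`, where the induction hypothesis applies to the remaining time. -/
lemma jumps_time_add (n : ℕ) (f : S → ℝ≥0∞) {s t : ℝ} (hs : 0 ≤ s) (ht : 0 ≤ t) (x : S) :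
    jumps q k n f (s + t) x
      = ∑ p ∈ Finset.HasAntidiagonal.antidiagonal n, jumps q k p.1 (jumps q k p.2 f t) s x := by
  induction n generalizing s x with
  | zero => simp [jumps, hold_add, mul_assoc]
  | succ n ih =>
    rw [Finset.Nat.sum_antidiagonal_succ]
    have hsplit : Set.Icc (0 : ℝ) (s + t) = Set.Icc 0 s ∪ Set.Ioc s (s + t) :=
      (Set.Icc_union_Ioc_eq_Icc hs (by linarith)).symm
    have h1 : ∫⁻ u in Set.Icc (0 : ℝ) s, hold q u x * jumpOp k (jumps q k n f (s + t - u)) x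
        = ∑ p ∈ Finset.HasAntidiagonal.antidiagonal n,
            jumps q k (p.1 + 1) (jumps q k p.2 f t) s x := by
      simp only [jumps]
      rw [← lintegral_finsetSum _ fun p _ => measurable_integrand p.1 _ s x]
      refine setLIntegral_congr_fun measurableSet_Icc fun u hu => ?_
      rw [← Finset.mul_sum, ← jumpOp_sum]
      congr 2
      funext y
      rw [← ih (by linarith [hu.2]) y]
      ring_nf
    have h2 : ∫⁻ u in Set.Ioc s (s + t), hold q u x * jumpOp k (jumps q k n f (s + t - u)) x
        = jumps q k 0 (jumps q k (n + 1) f t) s x := by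
      simp only [jumps]
      rw [← lintegral_const_mul _ (measurable_integrand n f t x),
        setLIntegral_congr Ioc_ae_eq_Icc]
      rw [← lintegral_indicator measurableSet_Icc, ← lintegral_indicator measurableSet_Icc,
        ← lintegral_add_left_eq_self _ s]
      refine lintegral_congr fun u => ?_
      simp only [Set.indicator, Set.mem_Icc, le_add_iff_nonneg_right, add_le_add_iff_left,
        hold_add, add_sub_add_left_eq_sub, mul_assoc]
    rw [← h1, ← h2, add_comm (∫⁻ u in Set.Ioc s (s + t), _),
      ← lintegral_union measurableSet_Ioc, ← hsplit]
    · rfl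
    · exact Set.disjoint_left.2 fun u hu hu' => absurd hu.2 (not_le.2 hu'.1)

lemma semigroup_tsum {ι : Type*} [Countable ι] (f : ι → S → ℝ≥0∞) (t : ℝ) (x : S) :
    semigroup q k t (fun y => ∑' i, f i y) x = ∑' i, semigroup q k t (f i) x := by
  unfold semigroup
  simp_rw [jumps_tsum]
  exact ENNReal.tsum_comm

lemma semigroup_const_mul (c : ℝ≥0∞) (f : S → ℝ≥0∞) (t : ℝ) (x : S) :
    semigroup q k t (fun y => c * f y) x = c * semigroup q k t f x := by
  unfold semigroup
  simp_rw [jumps_const_mul, ENNReal.tsum_mul_left]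

lemma semigroup_time_add (f : S → ℝ≥0∞) {s t : ℝ} (hs : 0 ≤ s) (ht : 0 ≤ t) (x : S) :
    semigroup q k (s + t) f x = semigroup q k s (semigroup q k t f) x := by
  have h : ∀ n, jumps q k n (semigroup q k t f) s x
      = ∑' m, jumps q k n (jumps q k m f t) s x := fun n =>
    jumps_tsum n (fun m => jumps q k m f t) s x
  unfold semigroup at h ⊢
  simp_rw [h, jumps_time_add _ f hs ht]
  rw [← ENNReal.tsum_prod, ← Finset.HasAntidiagonal.sigmaAntidiagonalEquivProd.tsum_eq,
    ENNReal.tsum_sigma']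
  refine tsum_congr fun n => ?_
  rw [tsum_fintype, ← Finset.sum_coe_sort]
  rfl

lemma semigroup_eq_tsum (f : S → ℝ≥0∞) (t : ℝ) (x : S) :
    semigroup q k t f x = ∑' y, prob q k t x y * f y := by
  classical
  have : f = fun z => ∑' y, f y * if z = y then 1 else 0 := by
    funext z
    rw [tsum_eq_single z (fun y hy => by simp [hy.symm])]
    simp
  conv_lhs => rw [this]
  rw [semigroup_tsum]
  refine tsum_congr fun y => ?_
  rw [semigroup_const_mul, mul_comm]
  unfold prob
  congr!

/-! ### Absence of explosions -/

lemma measurable_tail (n : ℕ) (x : S) : Measurable fun t => tail q k n t x := by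
  induction n generalizing x with
  | zero => exact measurable_const
  | succ n ih =>
    refine measurable_setLIntegral_Icc (F := fun t s =>
      hold q s x * jumpOp k (tail q k n (t - s)) x) ?_ measurable_id
    exact ((measurable_hold x).comp measurable_snd).mul
      (measurable_jumpOp (h := fun p : ℝ × ℝ => tail q k n (p.1 - p.2)) (fun y =>
        (ih y).comp (measurable_fst.sub measurable_snd)) x)

/-- Condition on the first jump: since the jump rates out of `x` add up to `q x`, the remaining mass
is `1 - exp (-q t)`, and no jump contributes `exp (-q t)`. -/
lemma sum_jumps_add_tail (hq : ∀ x, 0 ≤ q x) (hk : ∀ x, ∑' y, k x y = ENNReal.ofReal (q x))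
    (n : ℕ) {t : ℝ} (ht : 0 ≤ t) (x : S) :
    ∑ i ∈ Finset.range n, jumps q k i (fun _ => 1) t x + tail q k n t x = 1 := by
  induction n generalizing t x with
  | zero => simp [tail]
  | succ n ih =>
    rw [Finset.sum_range_succ', add_right_comm]
    simp only [jumps, tail]
    rw [← lintegral_finsetSum _ fun i _ => measurable_integrand i _ t x, ← lintegral_add_left
      (Finset.measurable_fun_sum _ fun i _ => measurable_integrand i _ t x)]
    have : ∀ s ∈ Set.Icc 0 t, (∑ i ∈ Finset.range n, hold q s x *
        jumpOp k (jumps q k i (fun _ => 1) (t - s)) x) + hold q s x *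
          jumpOp k (tail q k n (t - s)) x = ENNReal.ofReal (q x) * hold q s x := by
      intro s hs
      rw [← Finset.mul_sum, ← mul_add, ← jumpOp_sum, ← jumpOp_add,
        funext fun y => ih (by linarith [hs.2] : 0 ≤ t - s) y]
      simp [jumpOp, hk, mul_comm]
    rw [setLIntegral_congr_fun measurableSet_Icc this, lintegral_const_mul _ (measurable_hold x)]
    unfold hold
    rw [lintegral_exp_neg_mul (hq x) ht, mul_one,
      ← ENNReal.ofReal_add (by simpa using mul_nonneg (hq x) ht) (Real.exp_pos _).le]
    simp

/-- With `d` the number of jumps already made, `hV` says that `d + V` grows in mean at rate at most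
`c`, so `(d + V) exp (-c t)` is a supermartingale. After `n` more jumps the counter alone is `m`,
and the bound is Markov's inequality. -/
lemma tail_le {V : S → ℝ≥0∞} {c : ℝ} (hq : ∀ x, 0 ≤ q x) (hc : 0 ≤ c)
    (hV : ∀ (d : ℕ) x, jumpOp k (fun z => (d + 1 : ℕ) + V z) x
      ≤ ENNReal.ofReal (q x + c) * (d + V x))
    (m n d : ℕ) (hm : n + d = m) {t : ℝ} (ht : 0 ≤ t) (x : S) :
    m * tail q k n t x ≤ (d + V x) * ENNReal.ofReal (Real.exp (c * t)) := by
  induction n generalizing d t x with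
  | zero =>
    have : (1 : ℝ≥0∞) ≤ ENNReal.ofReal (Real.exp (c * t)) :=
      ENNReal.one_le_ofReal.2 (Real.one_le_exp (mul_nonneg hc ht))
    rw [zero_add] at hm
    subst hm
    calc (d : ℝ≥0∞) * tail q k 0 t x = d * 1 := rfl
      _ ≤ _ := mul_le_mul' le_self_add this
  | succ n ih =>
    simp only [tail]
    have hmeas : Measurable fun s => hold q s x * jumpOp k (tail q k n (t - s)) x :=
      (measurable_hold x).mul (measurable_jumpOp (fun y => (measurable_tail n y).comp
        (measurable_const.sub measurable_id)) x)
    rw [← lintegral_const_mul _ hmeas]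
    have hle : ∀ s ∈ Set.Icc 0 t, m * (hold q s x * jumpOp k (tail q k n (t - s)) x)
        ≤ ((d + V x) * ENNReal.ofReal (Real.exp (c * t))) * (ENNReal.ofReal (q x + c) *
          ENNReal.ofReal (Real.exp (-((q x + c) * s)))) := by
      intro s hs
      calc m * (hold q s x * jumpOp k (tail q k n (t - s)) x)
          = hold q s x * jumpOp k (fun y => m * tail q k n (t - s) y) x := by
            rw [jumpOp_const_mul]; ring
        _ ≤ hold q s x * jumpOp k (fun y => ENNReal.ofReal (Real.exp (c * (t - s))) *
              ((d + 1 : ℕ) + V y)) x := by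
            gcongr
            refine jumpOp_mono (fun y => ?_) x
            rw [mul_comm (ENNReal.ofReal _)]
            exact ih (d + 1) (by omega) (by linarith [hs.2]) y
        _ ≤ hold q s x * (ENNReal.ofReal (Real.exp (c * (t - s))) *
              (ENNReal.ofReal (q x + c) * (d + V x))) := by
            rw [jumpOp_const_mul]
            gcongr
            exact hV d x
        _ = (d + V x) * ENNReal.ofReal (q x + c) *
              (hold q s x * ENNReal.ofReal (Real.exp (c * (t - s)))) := by ring
        -- Collecting the exponents produces the density of an exponential time of rate `q x + c`,
        -- with mass at most `1`.
        _ = (d + V x) * ENNReal.ofReal (q x + c) * (ENNReal.ofReal (Real.exp (c * t)) *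
              ENNReal.ofReal (Real.exp (-((q x + c) * s)))) := by
            unfold hold
            rw [← ENNReal.ofReal_mul (Real.exp_pos _).le, ← ENNReal.ofReal_mul (Real.exp_pos _).le,
              ← Real.exp_add, ← Real.exp_add]
            ring_nf
        _ = _ := by ring
    refine (setLIntegral_mono' measurableSet_Icc hle).trans ?_
    rw [lintegral_const_mul _ (by fun_prop), lintegral_const_mul _ (by fun_prop),
      lintegral_exp_neg_mul (add_nonneg (hq x) hc) ht]
    refine mul_le_of_le_one_right' ?_
    rw [ENNReal.ofReal_le_one]
    linarith [Real.exp_pos (-((q x + c) * t))]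

/-- A chain with a Lyapunov function does not explode. -/
lemma semigroup_one {V : S → ℝ≥0∞} {c : ℝ} (hq : ∀ x, 0 ≤ q x)
    (hk : ∀ x, ∑' y, k x y = ENNReal.ofReal (q x)) (hc : 0 ≤ c) (hVtop : ∀ x, V x ≠ ∞)
    (hV : ∀ (d : ℕ) x, jumpOp k (fun z => (d + 1 : ℕ) + V z) x
      ≤ ENNReal.ofReal (q x + c) * (d + V x))
    {t : ℝ} (ht : 0 ≤ t) (x : S) : semigroup q k t (fun _ => 1) x = 1 := by
  have htail : Tendsto (fun n => tail q k n t x) atTop (𝓝 0) := by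
    set C := V x * ENNReal.ofReal (Real.exp (c * t)) with hC
    have hCtop : C ≠ ∞ := ENNReal.mul_ne_top (hVtop x) ENNReal.ofReal_ne_top
    have h0 : Tendsto (fun n : ℕ => C / n) atTop (𝓝 0) := by
      simpa using ENNReal.Tendsto.const_div ENNReal.tendsto_nat_nhds_top (Or.inr hCtop)
    refine tendsto_of_tendsto_of_tendsto_of_le_of_le' tendsto_const_nhds h0
      (Eventually.of_forall fun _ => zero_le) ?_
    filter_upwards [eventually_ge_atTop 1] with n hn
    rw [ENNReal.le_div_iff_mul_le (Or.inl (by simp; omega)) (Or.inl (by simp)), mul_comm]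
    simpa using tail_le hq hc hV n n 0 (add_zero n) ht x
  have h1 : Tendsto (fun n => ∑ i ∈ Finset.range n, jumps q k i (fun _ => 1) t x + tail q k n t x)
      atTop (𝓝 (semigroup q k t (fun _ => 1) x + 0)) :=
    (ENNReal.tendsto_nat_tsum _).add htail
  simp_rw [sum_jumps_add_tail hq hk _ ht x] at h1
  simpa using (tendsto_nhds_unique h1 tendsto_const_nhds)

end JumpChain

/-! ### Convergence to equilibrium of reversible chains -/

namespace JumpChain

/-- The distance of two finite extended nonnegative numbers. -/
noncomputable def gap (a b : ℝ≥0∞) : ℝ≥0∞ := (a - b) + (b - a)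

/-- The expansion of `(a - b)²`, arranged without subtraction; it yields both the Dirichlet form and
the Cauchy estimate. -/
lemma mul_self_add_mul_self {a b : ℝ≥0∞} (ha : a ≠ ∞) (hb : b ≠ ∞) :
    a * a + b * b = 2 * (a * b) + gap a b * gap a b := by
  wlog h : a ≤ b generalizing a b
  · rw [add_comm, this hb ha (le_of_not_ge h), gap, gap, add_comm (a - b), mul_comm a b]
  obtain ⟨c, rfl⟩ := exists_add_of_le h
  have : a + c - a = c := ENNReal.add_sub_cancel_left ha
  simp only [gap, this, tsub_eq_zero_of_le h, zero_add]
  ring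

lemma gap_eq_zero {a b : ℝ≥0∞} : gap a b = 0 ↔ a = b := by
  simp only [gap, add_eq_zero, tsub_eq_zero_iff_le]
  exact ⟨fun h => le_antisymm h.1 h.2, fun h => ⟨h.le, h.ge⟩⟩

lemma gap_toReal {a b : ℝ≥0∞} (ha : a ≠ ∞) (hb : b ≠ ∞) :
    (gap a b).toReal = |a.toReal - b.toReal| := by
  wlog h : a ≤ b generalizing a b
  · rw [abs_sub_comm, ← this hb ha (le_of_not_ge h), gap, gap, add_comm]
  have h' : a.toReal ≤ b.toReal := ENNReal.toReal_mono hb h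
  rw [gap, tsub_eq_zero_of_le h, zero_add, ENNReal.toReal_sub_of_le h hb,
    abs_sub_comm, abs_of_nonneg (sub_nonneg.2 h')]

variable {S : Type*}

/-- A chain that does not explode and that is reversible with respect to the finite weights `π` as
far as functions without a separation of `r`-related points are concerned. -/
structure IsReversible (q : S → ℝ) (k : S → S → ℝ≥0∞) (r : S → S → Prop) (π : S → ℝ≥0∞) :
    Prop where
  exit_nonneg : ∀ x, 0 ≤ q x
  exit_invariant : Invariant r q
  jumpOp_invariant : ∀ f, Invariant r f → Invariant r (jumpOp k f)
  symmetric : ∀ f g, Invariant r f → Invariant r g →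
    pairing π g (jumpOp k f) = pairing π (jumpOp k g) f
  conservative : ∀ t, 0 ≤ t → ∀ x, semigroup q k t (fun _ => 1) x = 1
  weight_ne_zero : ∀ x, π x ≠ 0
  weight_finite : ∑' x, π x ≠ ∞
  connected : ∀ g : S → ℝ≥0∞, (∀ x y, k x y ≠ 0 → g x = g y) → ∀ x y, g x = g y

namespace IsReversible

variable {q : S → ℝ} {k : S → S → ℝ≥0∞} {r : S → S → Prop} {π : S → ℝ≥0∞}

/-- Dominated convergence for the counting measure. -/
lemma tendsto_tsum_mul {m : S → ℝ≥0∞} (hm : ∑' x, m x ≠ ∞) {u : ℝ → S → ℝ≥0∞} {g : S → ℝ≥0∞}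
    (hu : ∀ᶠ t in atTop, ∀ x, u t x ≤ 1) (hg : ∀ x, Tendsto (fun t => u t x) atTop (𝓝 (g x))) :
    Tendsto (fun t => ∑' x, m x * u t x) atTop (𝓝 (∑' x, m x * g x)) := by
  let _ : MeasurableSpace S := ⊤
  simp_rw [← lintegral_count]
  refine tendsto_lintegral_filter_of_dominated_convergence m
    (Eventually.of_forall fun _ => measurable_from_top) ?_ (by rwa [lintegral_count]) ?_
  · filter_upwards [hu] with t ht
    exact Eventually.of_forall fun x => mul_le_of_le_one_right' (ht x)
  · refine Eventually.of_forall fun x => ENNReal.Tendsto.const_mul (hg x) (Or.inr ?_)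
    exact ne_top_of_le_ne_top hm (ENNReal.le_tsum x)

lemma semigroup_le_one (h : IsReversible q k r π)
    {f : S → ℝ≥0∞} (hf : ∀ x, f x ≤ 1) {t : ℝ} (ht : 0 ≤ t) (x : S) :
    semigroup q k t f x ≤ 1 :=
  (semigroup_mono hf t x).trans (h.conservative t ht x).le

lemma semigroup_invariant (h : IsReversible q k r π) {f : S → ℝ≥0∞} (hf : Invariant r f) (t : ℝ) :
    Invariant r (semigroup q k t f) :=
  Invariant.semigroup h.exit_invariant h.jumpOp_invariant hf t

lemma pairing_ne_top (h : IsReversible q k r π)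
    {u v : S → ℝ≥0∞} (hu : ∀ x, u x ≤ 1) (hv : ∀ x, v x ≤ 1) :
    pairing π u v ≠ ∞ :=
  ne_top_of_le_ne_top h.weight_finite
    (ENNReal.tsum_le_tsum fun x => mul_le_of_le_one_right' (mul_le_one' (hu x) (hv x)))

lemma weight_ne_top (h : IsReversible q k r π) (x : S) : π x ≠ ∞ :=
  ne_top_of_le_ne_top h.weight_finite (ENNReal.le_tsum x)

variable [Countable S]

lemma pairing_symm (h : IsReversible q k r π)
    {f g : S → ℝ≥0∞} (hf : Invariant r f) (hg : Invariant r g) (t : ℝ) :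
    pairing π g (semigroup q k t f) = pairing π (semigroup q k t g) f :=
  pairing_semigroup h.exit_invariant h.jumpOp_invariant h.symmetric hf hg t

lemma tsum_prob (h : IsReversible q k r π)
    {t : ℝ} (ht : 0 ≤ t) (x : S) : ∑' y, prob q k t x y = 1 := by
  have := semigroup_eq_tsum (q := q) (k := k) (fun _ => 1) t x
  rw [h.conservative t ht x] at this
  simpa using this.symm

/-- Stationarity of the weights: symmetry against the constant function `1`, which the semigroup
preserves. -/
lemma tsum_mul_semigroup (h : IsReversible q k r π)
    {f : S → ℝ≥0∞} (hf : Invariant r f) {t : ℝ} (ht : 0 ≤ t) :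
    ∑' x, π x * semigroup q k t f x = ∑' x, π x * f x := by
  have := h.pairing_symm (g := fun _ => 1) hf (fun _ _ _ => rfl) t
  simpa [pairing, h.conservative t ht] using this

/-- Expand the squares of `u x - u y` under the law of one step of length `t`; stationarity applied
to `u²` makes the two square terms equal. -/
lemma dirichlet (h : IsReversible q k r π)
    {u : S → ℝ≥0∞} (hu : Invariant r u) (hu1 : ∀ x, u x ≤ 1) {t : ℝ} (ht : 0 ≤ t) :
    2 * pairing π u u = 2 * pairing π u (semigroup q k t u) +
      ∑' x, π x * ∑' y, prob q k t x y * (gap (u x) (u y) * gap (u x) (u y)) := by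
  have hfin : ∀ x, u x ≠ ∞ := fun x => ne_top_of_le_ne_top ENNReal.one_ne_top (hu1 x)
  have h1 : ∀ x, u x * u x + semigroup q k t (fun y => u y * u y) x =
      2 * (u x * semigroup q k t u x) +
        ∑' y, prob q k t x y * (gap (u x) (u y) * gap (u x) (u y)) := by
    intro x
    calc u x * u x + semigroup q k t (fun y => u y * u y) x
        = ∑' y, prob q k t x y * (u x * u x + u y * u y) := by
          simp_rw [mul_add, ENNReal.tsum_add]
          rw [ENNReal.tsum_mul_right, h.tsum_prob ht, one_mul, ← semigroup_eq_tsum]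
      _ = ∑' y, (2 * (u x * (prob q k t x y * u y)) +
            prob q k t x y * (gap (u x) (u y) * gap (u x) (u y))) := by
          refine tsum_congr fun y => ?_
          rw [mul_self_add_mul_self (hfin x) (hfin y)]
          ring
      _ = _ := by
          rw [ENNReal.tsum_add, ENNReal.tsum_mul_left, ENNReal.tsum_mul_left, ← semigroup_eq_tsum]
  calc 2 * pairing π u u
      = ∑' x, π x * (u x * u x) + ∑' x, π x * semigroup q k t (fun y => u y * u y) x := by
        rw [h.tsum_mul_semigroup (hu.mul hu) ht, two_mul]; rfl
    _ = ∑' x, (2 * (π x * (u x * semigroup q k t u x)) +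
          π x * ∑' y, prob q k t x y * (gap (u x) (u y) * gap (u x) (u y))) := by
        rw [← ENNReal.tsum_add]
        refine tsum_congr fun x => ?_
        rw [← mul_add, h1 x]
        ring
    _ = _ := by rw [ENNReal.tsum_add, ENNReal.tsum_mul_left]; rfl

lemma pairing_semigroup_add (h : IsReversible q k r π)
    {f : S → ℝ≥0∞} (hf : Invariant r f) {s t : ℝ} (hs : 0 ≤ s)
    (ht : 0 ≤ t) :
    pairing π (semigroup q k s f) (semigroup q k t f) = pairing π f (semigroup q k (s + t) f) := by
  rw [← h.pairing_symm (h.semigroup_invariant hf t) hf s]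
  congr 1
  exact funext fun x => (semigroup_time_add f hs ht x).symm

/-- This is the nonnegativity of the Dirichlet form of `P_{a/2} f` over the time `b - a`. -/
lemma pairing_antitone (h : IsReversible q k r π)
    {f : S → ℝ≥0∞} (hf : Invariant r f) (hf1 : ∀ x, f x ≤ 1) {a b : ℝ}
    (ha : 0 ≤ a) (hab : a ≤ b) :
    pairing π f (semigroup q k b f) ≤ pairing π f (semigroup q k a f) := by
  have ha2 : 0 ≤ a / 2 := by linarith
  have hd := h.dirichlet (h.semigroup_invariant hf (a / 2)) (h.semigroup_le_one hf1 ha2)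
    (sub_nonneg.2 hab)
  rw [← show _ = semigroup q k (b - a) (semigroup q k (a / 2) f) from
      funext fun x => semigroup_time_add f (sub_nonneg.2 hab) ha2 x,
    h.pairing_semigroup_add hf ha2 ha2, h.pairing_semigroup_add hf ha2 (by linarith),
    show a / 2 + a / 2 = a by ring, show a / 2 + (b - a + a / 2) = b by ring] at hd
  have hle : 2 * pairing π f (semigroup q k b f) ≤ 2 * pairing π f (semigroup q k a f) :=
    hd ▸ le_self_add
  exact (ENNReal.mul_le_mul_iff_right two_ne_zero ENNReal.ofNat_ne_top).1 hle

lemma pairing_gap (h : IsReversible q k r π)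
    {f : S → ℝ≥0∞} (hf : Invariant r f) (hf1 : ∀ x, f x ≤ 1) {s t : ℝ}
    (hs : 0 ≤ s) (ht : 0 ≤ t) :
    pairing π f (semigroup q k (s + s) f) + pairing π f (semigroup q k (t + t) f) =
      2 * pairing π f (semigroup q k (s + t) f) +
        ∑' x, π x * (gap (semigroup q k s f x) (semigroup q k t f x) *
          gap (semigroup q k s f x) (semigroup q k t f x)) := by
  rw [← h.pairing_semigroup_add hf hs hs, ← h.pairing_semigroup_add hf ht ht,
    ← h.pairing_semigroup_add hf hs ht]
  unfold pairing
  rw [← ENNReal.tsum_add, ← ENNReal.tsum_mul_left, ← ENNReal.tsum_add]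
  refine tsum_congr fun x => ?_
  rw [← mul_add, mul_self_add_mul_self
    (ne_top_of_le_ne_top ENNReal.one_ne_top (h.semigroup_le_one hf1 hs x))
    (ne_top_of_le_ne_top ENNReal.one_ne_top (h.semigroup_le_one hf1 ht x))]
  ring

/-- Beyond `T` the values of `⟨f, P_t f⟩` lie between their infimum `L` and `L + ε`, so
`pairing_gap` leaves at most `2 (L + ε) - 2 L`. -/
lemma exists_gap_le (h : IsReversible q k r π)
    {f : S → ℝ≥0∞} (hf : Invariant r f) (hf1 : ∀ x, f x ≤ 1) {ε : ℝ≥0∞}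
    (hε : ε ≠ 0) :
    ∃ T : ℝ, 0 ≤ T ∧ ∀ s t, T ≤ s → T ≤ t →
      ∑' x, π x * (gap (semigroup q k s f x) (semigroup q k t f x) *
          gap (semigroup q k s f x) (semigroup q k t f x)) ≤ ε + ε := by
  set φ : ℝ → ℝ≥0∞ := fun t => pairing π f (semigroup q k t f) with hφ
  set L : ℝ≥0∞ := ⨅ t : ℝ≥0, φ t with hL
  have hfin : ∀ t, 0 ≤ t → φ t ≠ ∞ := fun t ht =>
    h.pairing_ne_top hf1 (h.semigroup_le_one hf1 ht)
  have hLfin : L ≠ ∞ := ne_top_of_le_ne_top (hfin 0 le_rfl) (iInf_le (fun t : ℝ≥0 => φ t) 0)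
  obtain ⟨T, hT⟩ : ∃ T : ℝ≥0, φ T < L + ε :=
    exists_lt_of_ciInf_lt (ENNReal.lt_add_right hLfin hε)
  have hup : ∀ t, (T : ℝ) ≤ t → φ t ≤ L + ε := fun t ht =>
    (h.pairing_antitone hf hf1 T.2 ht).trans hT.le
  refine ⟨T, T.2, fun s t hs ht => ?_⟩
  have hs0 := T.2.trans hs
  have ht0 := T.2.trans ht
  have hlow : L ≤ φ (s + t) :=
    iInf_le_of_le (⟨s + t, add_nonneg hs0 ht0⟩ : ℝ≥0) le_rfl
  have hgap := h.pairing_gap hf hf1 hs0 ht0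
  refine (ENNReal.add_le_add_iff_left (a := 2 * φ (s + t))
    (ENNReal.mul_ne_top ENNReal.ofNat_ne_top (hfin _ (add_nonneg hs0 ht0)))).1 ?_
  calc _ = φ (s + s) + φ (t + t) := hgap.symm
    _ ≤ (L + ε) + (L + ε) := add_le_add (hup _ (by linarith)) (hup _ (by linarith))
    _ = 2 * L + (ε + ε) := by ring
    _ ≤ _ := by gcongr

lemma exists_tendsto (h : IsReversible q k r π)
    {f : S → ℝ≥0∞} (hf : Invariant r f) (hf1 : ∀ x, f x ≤ 1) (x : S) :
    ∃ g : ℝ≥0∞, g ≤ 1 ∧ Tendsto (fun t => semigroup q k t f x) atTop (𝓝 g) := by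
  have hfin : ∀ t, 0 ≤ t → semigroup q k t f x ≠ ∞ := fun t ht =>
    ne_top_of_le_ne_top ENNReal.one_ne_top (h.semigroup_le_one hf1 ht x)
  have hπ : 0 < (π x).toReal := ENNReal.toReal_pos (h.weight_ne_zero x) (h.weight_ne_top x)
  have hc : CauchySeq fun t => (semigroup q k t f x).toReal := by
    rw [Metric.cauchySeq_iff]
    intro ε hε
    -- Two copies of this bound give `π x * (ε / 2) ^ 2`, hence a distance of at most `ε / 2` at the
    -- point `x`.
    have hδ : 0 < (π x).toReal * (ε / 2) ^ 2 / 2 := by positivity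
    obtain ⟨T, hT0, hT⟩ := h.exists_gap_le hf hf1 (ENNReal.ofReal_pos.2 hδ).ne'
    refine ⟨T, fun s hs t ht => ?_⟩
    have hs1 := hfin s (hT0.trans hs)
    have ht1 := hfin t (hT0.trans ht)
    have h1 := (ENNReal.le_tsum x).trans (hT s t hs ht)
    have h2 := ENNReal.toReal_mono (by simp) h1
    rw [← ENNReal.ofReal_add hδ.le hδ.le, ENNReal.toReal_ofReal (by linarith), ENNReal.toReal_mul,
      ENNReal.toReal_mul, gap_toReal hs1 ht1, add_halves, ← pow_two] at h2
    have h3 := le_of_mul_le_mul_left h2 hπ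
    have h4 := abs_le_of_sq_le_sq' h3 (by linarith)
    rw [Real.dist_eq]
    linarith [h4.2]
  obtain ⟨l, hl⟩ := cauchySeq_tendsto_of_complete hc
  have ht : Tendsto (fun t => semigroup q k t f x) atTop (𝓝 (ENNReal.ofReal l)) := by
    refine (ENNReal.tendsto_ofReal hl).congr' ?_
    filter_upwards [eventually_ge_atTop 0] with t ht
    exact ENNReal.ofReal_toReal (hfin t ht)
  refine ⟨_, le_of_tendsto ht ?_, ht⟩
  filter_upwards [eventually_ge_atTop 0] with t ht
  exact h.semigroup_le_one hf1 ht x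

/-- Convergence to equilibrium. -/
theorem tendsto_semigroup (h : IsReversible q k r π)
    {f : S → ℝ≥0∞} (hf : Invariant r f) (hf1 : ∀ x, f x ≤ 1) (x : S) :
    Tendsto (fun t => semigroup q k t f x) atTop (𝓝 ((∑' x, π x * f x) / ∑' x, π x)) := by
  choose g hg1 hg using h.exists_tendsto hf hf1
  have hev : ∀ᶠ t in atTop, ∀ x, semigroup q k t f x ≤ 1 := by
    filter_upwards [eventually_ge_atTop 0] with t ht x using h.semigroup_le_one hf1 ht x
  have hginv : Invariant r g := fun x y hxy => tendsto_nhds_unique (hg x)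
    ((hg y).congr fun t => (h.semigroup_invariant hf t x y hxy).symm)
  -- `P_1 (P_t f) = P_{1+t} f`, and both sides converge.
  have hstat : semigroup q k 1 g = g := by
    funext x
    have h1 : Tendsto (fun t => ∑' y, prob q k 1 x y * semigroup q k t f y) atTop
        (𝓝 (∑' y, prob q k 1 x y * g y)) :=
      tendsto_tsum_mul (by simp [h.tsum_prob zero_le_one]) hev hg
    rw [← semigroup_eq_tsum] at h1
    refine tendsto_nhds_unique h1
      (((hg x).comp (tendsto_atTop_add_const_left _ 1 tendsto_id)).congr' ?_)
    filter_upwards [eventually_ge_atTop 0] with t ht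
    rw [← semigroup_eq_tsum, ← semigroup_time_add f zero_le_one ht]
    rfl
  have hd := h.dirichlet hginv hg1 zero_le_one
  rw [hstat] at hd
  have hzero : ∑' x, π x * ∑' y, prob q k 1 x y * (gap (g x) (g y) * gap (g x) (g y)) = 0 :=
    ((ENNReal.add_right_inj (ENNReal.mul_ne_top ENNReal.ofNat_ne_top
      (h.pairing_ne_top hg1 hg1))).1 ((add_zero _).trans hd)).symm
  -- All terms of the Dirichlet form vanish, so `g` agrees at any two states joined by a positive
  -- rate.
  have hconst := h.connected g fun x y hxy => by
    rw [ENNReal.tsum_eq_zero] at hzero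
    have h1 := (mul_eq_zero.1 (hzero x)).resolve_left (h.weight_ne_zero x)
    rw [ENNReal.tsum_eq_zero] at h1
    have h2 := (mul_eq_zero.1 (h1 y)).resolve_left (prob_pos hxy one_pos h.exit_nonneg).ne'
    exact gap_eq_zero.1 (mul_self_eq_zero.1 h2)
  -- The weighted sum is constant in time and passes to the limit, which fixes the constant value of
  -- `g`.
  have hmass : ∑' y, π y * g y = ∑' y, π y * f y := by
    refine tendsto_nhds_unique (tendsto_tsum_mul h.weight_finite hev hg)
      (tendsto_const_nhds.congr' ?_)
    filter_upwards [eventually_ge_atTop 0] with t ht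
    exact (h.tsum_mul_semigroup hf ht).symm
  convert hg x using 2
  have hne : ∑' y, π y ≠ 0 := fun h0 => h.weight_ne_zero x (ENNReal.tsum_eq_zero.1 h0 x)
  rw [← hmass, tsum_congr fun y => by rw [hconst y x], ENNReal.tsum_mul_right, mul_comm,
    ENNReal.mul_div_cancel_right hne h.weight_finite]

end IsReversible

end JumpChain

/-! ### Sums over lists -/

lemma tsum_list {α : Type*} (F : List α → ℝ≥0∞) :
    ∑' l, F l = F [] + ∑' a, ∑' l, F (a :: l) := by
  let e : Unit ⊕ (α × List α) ≃ List α :=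
    { toFun := Sum.elim (fun _ => []) fun p => p.1 :: p.2
      invFun := fun l => match l with
        | [] => Sum.inl ()
        | a :: l => Sum.inr (a, l)
      left_inv := by rintro (_ | ⟨a, l⟩) <;> rfl
      right_inv := by rintro (_ | ⟨a, l⟩) <;> rfl }
  rw [← e.tsum_eq, Summable.tsum_sum ENNReal.summable ENNReal.summable, ← ENNReal.tsum_prod,
    tsum_fintype]
  simp [e]

open Classical in
lemma list_sum_map_eq_tsum {α : Type*} (l : List α) (f : α → ℝ≥0∞) :
    (l.map f).sum = ∑' y, (l.map fun z => if z = y then (1 : ℝ≥0∞) else 0).sum * f y := by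
  induction l with
  | nil => simp
  | cons a l ih =>
    simp only [List.map_cons, List.sum_cons, add_mul, ENNReal.tsum_add, ← ih]
    congr 1
    rw [tsum_eq_single a (fun y hy => by simp [hy.symm])]
    simp

namespace RTree

/-! ### Structural facts on trees -/

/-- Replaces the two-motive recursor of the nested type by induction over the subtrees at the root.
-/
lemma induction_on {P : RTree → Prop} (h : ∀ cs, (∀ c ∈ cs, P c) → P (node cs)) (t : RTree) :
    P t :=
  RTree.rec (motive_1 := P) (motive_2 := fun cs => ∀ c ∈ cs, P c) h (by simp)
    (fun t ts ht hts c hc => by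
      rcases List.mem_cons.1 hc with rfl | hc
      · exact ht
      · exact hts c hc) t

/-- A tree is given by the list of the subtrees that hang from the root. -/
def nodeEquiv : List RTree ≃ RTree where
  toFun := node
  invFun t := match t with
    | node cs => cs
  left_inv _ := rfl
  right_inv := by rintro ⟨_⟩; rfl

lemma tsum_node (f : RTree → ℝ≥0∞) : ∑' t, f t = ∑' cs, f (node cs) :=
  (nodeEquiv.tsum_eq f).symm

mutual
/-- A numbering of the trees. -/
def code : RTree → ℕ
  | node cs => forestCode cs
/-- A numbering of the lists of trees. -/
def forestCode : List RTree → ℕ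
  | [] => 0
  | t :: ts => Nat.pair (code t) (forestCode ts) + 1
end

lemma code_injective : Function.Injective code := by
  intro s
  induction s using induction_on with
  | h cs ih =>
    rintro ⟨ds⟩ h
    simp only [code] at h
    congr 1
    induction cs generalizing ds with
    | nil =>
      cases ds with
      | nil => rfl
      | cons d ds => simp [forestCode] at h
    | cons c cs ihc =>
      cases ds with
      | nil => simp [forestCode] at h
      | cons d ds =>
        simp only [forestCode, Nat.add_right_cancel_iff, Nat.pair_eq_pair] at h
        rw [ih c List.mem_cons_self h.1,
          ihc (fun c hc => ih c (List.mem_cons_of_mem _ hc)) ds h.2]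

instance : Countable RTree := code_injective.countable

lemma volume_pos (t : RTree) : 0 < t.volume := by
  cases t; simp [volume]

lemma forestVolume_append (cs ds : List RTree) :
    forestVolume (cs ++ ds) = forestVolume cs + forestVolume ds := by
  induction cs with
  | nil => simp [forestVolume]
  | cons c cs ih => simp only [List.cons_append, forestVolume, ih]; ring

lemma forestVolume_perm {cs ds : List RTree} (h : cs.Perm ds) :
    forestVolume cs = forestVolume ds := by
  induction h with
  | nil => rfl
  | cons _ _ ih => simp [forestVolume, ih]
  | swap _ _ _ => simp only [forestVolume]; ring
  | trans _ _ h₁ h₂ => exact h₁.trans h₂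

lemma length_grown (t : RTree) : t.grown.length = t.volume := by
  induction t using induction_on with
  | h cs ih =>
    have : (forestGrown cs).length = forestVolume cs := by
      induction cs with
      | nil => rfl
      | cons c cs ihc =>
        simp [forestGrown, forestVolume, ih c List.mem_cons_self,
          ihc fun c hc => ih c (List.mem_cons_of_mem _ hc)]
    simp [grown, volume, this, add_comm]

lemma volume_of_mem_grown {t : RTree} : ∀ y ∈ t.grown, y.volume = t.volume + 1 := by
  induction t using induction_on with
  | h cs ih =>
    have : ∀ ds ∈ forestGrown cs, forestVolume ds = forestVolume cs + 1 := by
      induction cs with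
      | nil => simp [forestGrown]
      | cons c cs ihc =>
        have ihc' := ihc fun c hc => ih c (List.mem_cons_of_mem _ hc)
        intro ds hds
        simp only [forestGrown, List.mem_append, List.mem_map] at hds
        rcases hds with ⟨d, hd, rfl⟩ | ⟨es, hes, rfl⟩
        · simp only [forestVolume, ih c List.mem_cons_self d hd]; ring
        · simp only [forestVolume, ihc' es hes]; ring
    intro y hy
    simp only [grown, List.mem_cons, List.mem_map] at hy
    rcases hy with rfl | ⟨ds, hds, rfl⟩
    · simp [volume, forestVolume, single]; ring
    · simp only [volume, this ds hds]; ring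

/-- A lone vertex has nothing to prune below its root, so the two defining clauses merge into one.
-/
lemma forestPruned_cons (c : RTree) (cs : List RTree) [Decidable (c = single)] :
    forestPruned (c :: cs) = (if c = single then [cs] else []) ++
      (c.pruned.map (fun t => t :: cs) ++ (forestPruned cs).map (fun ts => c :: ts)) := by
  rcases c with ⟨_ | ⟨d, ds⟩⟩
  · rw [if_pos (show node [] = single from rfl)]; rfl
  · rw [if_neg (by simp [single])]; rfl

lemma volume_of_mem_pruned {t : RTree} : ∀ y ∈ t.pruned, y.volume + 1 = t.volume := by
  classical
  induction t using induction_on with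
  | h cs ih =>
    have : ∀ ds ∈ forestPruned cs, forestVolume ds + 1 = forestVolume cs := by
      induction cs with
      | nil => simp [forestPruned]
      | cons c cs ihc =>
        have ihc' := ihc fun c hc => ih c (List.mem_cons_of_mem _ hc)
        intro ds hds
        simp only [forestPruned_cons, List.mem_append, List.mem_map] at hds
        rcases hds with hds | ⟨d, hd, rfl⟩ | ⟨es, hes, rfl⟩
        · split_ifs at hds with h
          · subst h
            simp only [List.mem_singleton] at hds
            subst hds
            simp only [forestVolume, single, volume]; ring
          · simp at hds
        · simp only [forestVolume, ← ih c List.mem_cons_self d hd]; ring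
        · simp only [forestVolume, ← ihc' es hes]; ring
    intro y hy
    simp only [pruned, List.mem_map] at hy
    rcases hy with ⟨ds, hds, rfl⟩
    simp only [volume, ← this ds hds]; ring

lemma pruned_ne_nil {t : RTree} : t ≠ single → t.pruned ≠ [] := by
  classical
  induction t using induction_on with
  | h cs ih =>
    intro hne
    cases cs with
    | nil => exact absurd rfl hne
    | cons c cs =>
      simp only [pruned, forestPruned_cons, ne_eq, List.map_eq_nil_iff, List.append_eq_nil_iff,
        not_and]
      intro h1 h2
      by_cases hc : c = single
      · simp [hc] at h1
      · exact absurd h2 (ih c List.mem_cons_self hc)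

/-! ### Trees up to the order of siblings -/

/-- The relation that generates the equality of trees up to the order of siblings. -/
inductive Sim : RTree → RTree → Prop
  | perm {cs ds : List RTree} : cs.Perm ds → Sim (node cs) (node ds)
  | congr {c d : RTree} (l r : List RTree) : Sim c d → Sim (node (l ++ c :: r)) (node (l ++ d :: r))

lemma Sim.cons {cs ds : List RTree} (a : RTree) (h : Sim (node cs) (node ds)) :
    Sim (node (a :: cs)) (node (a :: ds)) := by
  generalize hx : node cs = x at h
  generalize hy : node ds = y at h
  cases h with
  | perm hp => cases hx; cases hy; exact .perm (hp.cons a)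
  | congr l r hs => cases hx; cases hy; exact .congr (a :: l) r hs

lemma Sim.volume_eq {x y : RTree} (h : Sim x y) : x.volume = y.volume := by
  induction h with
  | perm h => simp [volume, forestVolume_perm h]
  | congr l r _ ih => simp [volume, forestVolume_append, forestVolume, ih]

lemma Sim.eq_single_iff {x y : RTree} (h : Sim x y) : x = single ↔ y = single := by
  cases h with
  | perm h =>
    simp only [single, node.injEq]
    exact ⟨fun h' => by subst h'; exact List.nil_perm.1 h,
      fun h' => by subst h'; exact List.perm_nil.1 h⟩
  | congr l r h => simp [single]

open JumpChain

/-- Related trees have growths that can be matched term by term up to `Sim`; inside a modified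
subtree `c` the claim recurs with `f` composed with the surrounding tree. -/
lemma invariant_sum_grown {f : RTree → ℝ≥0∞} (hf : Invariant Sim f) :
    Invariant Sim fun x => (x.grown.map f).sum := by
  have hcons : ∀ (F : List RTree → ℝ≥0∞) (c : RTree) (cs : List RTree),
      ((forestGrown (c :: cs)).map F).sum = (c.grown.map fun t => F (t :: cs)).sum +
        ((forestGrown cs).map fun ts => F (c :: ts)).sum := fun F c cs => by
    simp [forestGrown, Function.comp_def]
  have happ : ∀ (F : List RTree → ℝ≥0∞) (l : List RTree) (c : RTree) (r : List RTree),
      ((forestGrown (l ++ c :: r)).map F).sum =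
        ((forestGrown l).map fun l' => F (l' ++ c :: r)).sum +
        (c.grown.map fun t => F (l ++ t :: r)).sum +
        ((forestGrown r).map fun r' => F (l ++ c :: r')).sum := by
    intro F l c r
    induction l generalizing F with
    | nil => simp [forestGrown, Function.comp_def]
    | cons a l ih =>
      simp only [List.cons_append, hcons, ih]
      ring
  intro x y h
  induction h generalizing f with
  | @perm cs ds h =>
    have : ∀ F : List RTree → ℝ≥0∞, (∀ l l', l.Perm l' → F l = F l') →
        ((forestGrown cs).map F).sum = ((forestGrown ds).map F).sum := by
      induction h with
      | nil => exact fun _ _ => rfl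
      | cons a h ih =>
        intro F hF
        rw [hcons, hcons, ih _ fun l l' hl => hF _ _ (hl.cons a)]
        congr 2
        exact List.map_congr_left fun t _ => hF _ _ (h.cons t)
      | swap a b l =>
        intro F hF
        simp only [hcons]
        rw [← add_assoc, ← add_assoc, add_comm (List.sum (List.map (fun t => F (t :: a :: l)) _))]
        congr 2
        · congr 1
          exact List.map_congr_left fun t _ => hF _ _ (.swap _ _ _)
        · congr 1
          exact List.map_congr_left fun t _ => hF _ _ (.swap _ _ _)
        · exact List.map_congr_left fun t _ => hF _ _ (.swap _ _ _)
      | trans _ _ h₁ h₂ => exact fun F hF => (h₁ F hF).trans (h₂ F hF)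
    simp only [grown, List.map_cons, List.sum_cons, List.map_map]
    rw [hf _ _ (.perm (h.cons single))]
    congr 1
    exact this _ fun l l' hl => hf _ _ (.perm hl)
  | @congr c d l r h ih =>
    simp only [grown, List.map_cons, List.sum_cons, List.map_map]
    rw [happ, happ, hf (node (single :: (l ++ c :: r))) (node (single :: (l ++ d :: r)))
      (.congr (single :: l) r h)]
    congr 3
    · congr 1
      exact List.map_congr_left fun t _ => hf _ _ (.congr _ _ h)
    · exact ih fun x y hxy => hf _ _ (.congr _ _ hxy)
    · exact List.map_congr_left fun t _ => hf _ _ (.congr _ _ h)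

open Classical in
lemma sum_forestPruned_cons (F : List RTree → ℝ≥0∞) (c : RTree) (cs : List RTree) :
    ((forestPruned (c :: cs)).map F).sum = (if c = single then F cs else 0) +
      (c.pruned.map fun t => F (t :: cs)).sum +
        ((forestPruned cs).map fun ts => F (c :: ts)).sum := by
  rw [forestPruned_cons, List.map_append, List.map_append, List.sum_append, List.sum_append,
    List.map_map, List.map_map, add_assoc]
  congr 1
  split_ifs <;> simp

/-- As for growth, with one more term for the disappearance of a subtree; `Sim` respects being a
single vertex. -/
lemma invariant_sum_pruned {f : RTree → ℝ≥0∞} (hf : Invariant Sim f) :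
    Invariant Sim fun x => (x.pruned.map f).sum := by
  classical
  have happ : ∀ (F : List RTree → ℝ≥0∞) (l : List RTree) (c : RTree) (r : List RTree),
      ((forestPruned (l ++ c :: r)).map F).sum =
        ((forestPruned l).map fun l' => F (l' ++ c :: r)).sum +
        (if c = single then F (l ++ r) else 0) +
        (c.pruned.map fun t => F (l ++ t :: r)).sum +
        ((forestPruned r).map fun r' => F (l ++ c :: r')).sum := by
    intro F l c r
    induction l generalizing F with
    | nil => simp [sum_forestPruned_cons, forestPruned]
    | cons a l ih =>
      simp only [List.cons_append, sum_forestPruned_cons, ih]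
      ring
  intro x y h
  induction h generalizing f with
  | @perm cs ds h =>
    have : ∀ F : List RTree → ℝ≥0∞, (∀ l l', l.Perm l' → F l = F l') →
        ((forestPruned cs).map F).sum = ((forestPruned ds).map F).sum := by
      induction h with
      | nil => exact fun _ _ => rfl
      | cons a h ih =>
        intro F hF
        rw [sum_forestPruned_cons, sum_forestPruned_cons, ih _ fun l l' hl => hF _ _ (hl.cons a),
          hF _ _ h]
        congr 3
        exact List.map_congr_left fun t _ => hF _ _ (h.cons t)
      | swap a b l =>
        intro F hF
        simp only [sum_forestPruned_cons]
        rw [List.map_congr_left fun t _ => hF (t :: a :: l) (a :: t :: l) (.swap _ _ _),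
          List.map_congr_left fun t _ => hF (t :: b :: l) (b :: t :: l) (.swap _ _ _),
          List.map_congr_left fun t _ => hF (b :: a :: t) (a :: b :: t) (.swap _ _ _)]
        ring
      | trans _ _ h₁ h₂ => exact fun F hF => (h₁ F hF).trans (h₂ F hF)
    simp only [pruned, List.map_map]
    exact this _ fun l l' hl => hf _ _ (.perm hl)
  | @congr c d l r h ih =>
    simp only [pruned, List.map_map]
    rw [happ, happ, if_congr h.eq_single_iff rfl rfl]
    refine congrArg₂ _ (congrArg₂ _ (congrArg₂ _ (congrArg _ ?_) rfl) ?_) (congrArg _ ?_)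
    · exact List.map_congr_left fun t _ => hf _ _ (.congr _ _ h)
    · exact ih fun x y hxy => hf _ _ (.congr _ _ hxy)
    · exact List.map_congr_left fun t _ => hf _ _ (.congr _ _ h)

/-! ### Detailed balance -/

mutual
/-- The weight of a tree: every vertex with `n` children contributes the factor `ρ / n!`. -/
noncomputable def weight (ρ : ℝ≥0∞) : RTree → ℝ≥0∞
  | node cs => ρ * (cs.length.factorial : ℝ≥0∞)⁻¹ * forestWeight ρ cs
/-- The product of the weights of a list of trees. -/
noncomputable def forestWeight (ρ : ℝ≥0∞) : List RTree → ℝ≥0∞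
  | [] => 1
  | t :: ts => weight ρ t * forestWeight ρ ts
end

open Classical in
/-- The number of positions at which a new tree with a single vertex can be inserted into `cs` so
that `ds` arises. -/
noncomputable def insertions : List RTree → List RTree → ℝ≥0∞
  | _, [] => 0
  | [], d :: ds => if d = single ∧ ds = [] then 1 else 0
  | c :: cs, d :: ds => (if d = single ∧ ds = c :: cs then 1 else 0) +
      if c = d then insertions cs ds else 0

open Classical in
mutual
/-- The rate from one tree to another when every vertex produces leaves at rate `1` and a new leaf
takes a uniformly distributed place among its siblings. -/
noncomputable def attach : RTree → RTree → ℝ≥0∞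
  | node cs, node ds => insertions cs ds * ((cs.length + 1 : ℕ) : ℝ≥0∞)⁻¹ + forestAttach cs ds
/-- The rate from one list of trees to another when every vertex produces leaves at rate `1` and a
new leaf takes a uniformly distributed place among its siblings. -/
noncomputable def forestAttach : List RTree → List RTree → ℝ≥0∞
  | [], _ => 0
  | _ :: _, [] => 0
  | c :: cs, d :: ds => (if cs = ds then attach c d else 0) +
      if c = d then forestAttach cs ds else 0
end

open Classical in
/-- The number of leaves of `x` the deletion of which leads to `y`. -/
noncomputable def prunings (x y : RTree) : ℝ≥0∞ :=
  (x.pruned.map fun z => if z = y then (1 : ℝ≥0∞) else 0).sum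

open Classical in
/-- The number of leaves the deletion of which leads from `ds` to `cs`, where leaves of
height zero are left out. -/
noncomputable def forestPrunings : List RTree → List RTree → ℝ≥0∞
  | [], _ => 0
  | _ :: _, [] => 0
  | d :: ds, c :: cs => (if cs = ds then prunings d c else 0) +
      if c = d then forestPrunings ds cs else 0

lemma weight_single (ρ : ℝ≥0∞) : weight ρ single = ρ := by
  simp [single, weight, forestWeight]

/-- A deleted leaf either hangs from the root, and its deletion undoes an insertion, or it lies
deeper in one subtree. -/
lemma prunings_node (ds cs : List RTree) :
    prunings (node ds) (node cs) = insertions cs ds + forestPrunings ds cs := by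
  classical
  have : prunings (node ds) (node cs)
      = ((forestPruned ds).map fun l => if l = cs then (1 : ℝ≥0∞) else 0).sum := by
    simp [prunings, pruned, Function.comp_def]
  rw [this]
  clear this
  induction ds generalizing cs with
  | nil => simp [forestPruned, insertions, forestPrunings]
  | cons d ds ih =>
    rw [sum_forestPruned_cons]
    cases cs with
    | nil => simp [insertions, forestPrunings, ite_and]
    | cons c cs =>
      simp only [insertions, forestPrunings, List.cons.injEq, ite_and]
      have h1 : (d.pruned.map fun t => if t = c then if ds = cs then (1 : ℝ≥0∞) else 0 else 0).sum
          = if cs = ds then prunings d c else 0 := by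
        unfold prunings
        by_cases h : ds = cs <;> simp [h, eq_comm]
      have h2 : ((forestPruned ds).map fun ts =>
            if d = c then if ts = cs then (1 : ℝ≥0∞) else 0 else 0).sum
          = (if c = d then insertions cs ds else 0) + if c = d then forestPrunings ds cs else 0 := by
        by_cases h : d = c
        · simp [h, ih]
        · simp [h, Ne.symm h]
      rw [h1, h2]
      ring

lemma insertions_weight (ρ : ℝ≥0∞) (cs ds : List RTree) :
    forestWeight ρ ds * insertions cs ds = ρ * forestWeight ρ cs * insertions cs ds := by
  induction ds generalizing cs with
  | nil => cases cs <;> simp [insertions]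
  | cons d ds ih =>
    cases cs with
    | nil =>
      simp only [insertions]
      split_ifs with h
      · rw [h.1, h.2]; simp [forestWeight, weight_single]
      · simp
    | cons c cs =>
      simp only [insertions, mul_add]
      congr 1
      · split_ifs with h
        · rw [h.1, h.2]; simp only [forestWeight, weight_single]
        · simp
      · split_ifs with h
        · subst h
          simp only [forestWeight, mul_assoc, ih]
          ring
        · simp

lemma insertions_length {cs ds : List RTree} (h : insertions cs ds ≠ 0) :
    ds.length = cs.length + 1 := by
  induction ds generalizing cs with
  | nil => cases cs <;> simp [insertions] at h
  | cons d ds ih =>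
    cases cs with
    | nil =>
      simp only [insertions, ne_eq, ite_eq_right_iff, not_forall] at h
      obtain ⟨⟨_, h⟩, _⟩ := h
      simp [h]
    | cons c cs =>
      simp only [insertions] at h
      by_cases h1 : d = single ∧ ds = c :: cs
      · simp [h1.2]
      · rw [if_neg h1, zero_add] at h
        have := ih (cs := cs) (fun h0 => h (by simp [h0]))
        simp [this]

lemma forestAttach_length {cs ds : List RTree} (h : forestAttach cs ds ≠ 0) :
    ds.length = cs.length := by
  induction ds generalizing cs with
  | nil => cases cs <;> simp [forestAttach] at h ⊢
  | cons d ds ih =>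
    cases cs with
    | nil => simp [forestAttach] at h
    | cons c cs =>
      simp only [forestAttach] at h
      by_cases h1 : cs = ds
      · simp [h1]
      · rw [if_neg h1, zero_add] at h
        have := ih (cs := cs) (fun h0 => h (by simp [h0]))
        simp [this]

/-- At the root, the insertion probability `1 / (n + 1)` turns `1 / n!` into `1 / (n + 1)!` and the
new leaf has weight `ρ`. Deeper changes leave the number of children of the root alone and follow by
recursion. -/
lemma detailed_balance (ρ : ℝ≥0∞) (x y : RTree) :
    ρ * (weight ρ x * attach x y) = weight ρ y * prunings y x := by
  induction x using induction_on generalizing y with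
  | h cs ih =>
    obtain ⟨ds⟩ := y
    have hf : ρ * (forestWeight ρ cs * forestAttach cs ds)
        = forestWeight ρ ds * forestPrunings ds cs := by
      induction cs generalizing ds with
      | nil => cases ds <;> simp [forestAttach, forestPrunings]
      | cons c cs ihc =>
        cases ds with
        | nil => simp [forestAttach, forestPrunings]
        | cons d ds =>
          simp only [forestAttach, forestPrunings, forestWeight, mul_add]
          congr 1
          · split_ifs with h
            · subst h
              have := ih c List.mem_cons_self d
              calc _ = ρ * (weight ρ c * attach c d) * forestWeight ρ cs := by ring
                _ = _ := by rw [this]; ring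
            · simp
          · split_ifs with h
            · subst h
              have := ihc (fun c hc => ih c (List.mem_cons_of_mem _ hc)) ds
              calc _ = weight ρ c * (ρ * (forestWeight ρ cs * forestAttach cs ds)) := by ring
                _ = _ := by rw [this]; ring
            · simp
    rw [prunings_node]
    simp only [weight, attach, mul_add]
    congr 1
    -- Only a nonzero count forces the relation between the lengths that the factorials need.
    · by_cases h0 : insertions cs ds = 0
      · simp [h0]
      · rw [insertions_length h0, Nat.factorial_succ, Nat.cast_mul,
          ENNReal.mul_inv (by simp) (by simp)]
        calc _ = ρ * ((cs.length + 1 : ℕ) : ℝ≥0∞)⁻¹ * (cs.length.factorial : ℝ≥0∞)⁻¹ *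
              (ρ * forestWeight ρ cs * insertions cs ds) := by ring
          _ = _ := by rw [← insertions_weight]; ring
    · by_cases h0 : forestAttach cs ds = 0
      · rw [h0, mul_zero, mul_zero] at hf
        rw [h0, mul_zero, mul_zero, mul_assoc, ← hf, mul_zero]
      · rw [forestAttach_length h0]
        calc _ = ρ * (cs.length.factorial : ℝ≥0∞)⁻¹ *
              (ρ * (forestWeight ρ cs * forestAttach cs ds)) := by ring
          _ = _ := by rw [hf]; ring

/-- All `cs.length + 1` insertions are permutations of `single :: cs`, and `F` does not distinguish
them. -/
lemma tsum_insertions {F : List RTree → ℝ≥0∞}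
    (hF : ∀ cs ds, Sim (node cs) (node ds) → F cs = F ds) (cs : List RTree) :
    ∑' ds, insertions cs ds * F ds = (cs.length + 1 : ℕ) * F (single :: cs) := by
  classical
  induction cs generalizing F with
  | nil =>
    rw [tsum_eq_single [single]]
    · simp [insertions]
    · rintro (_ | ⟨d, ds⟩) hne
      · simp [insertions]
      · simp only [insertions, ite_mul, zero_mul, one_mul, ite_eq_right_iff]
        rintro ⟨rfl, rfl⟩
        exact absurd rfl hne
  | cons c cs ih =>
    rw [tsum_list]
    simp only [insertions, zero_mul, zero_add, add_mul, ENNReal.tsum_add]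
    have h1 : ∑' a, ∑' l, (if a = single ∧ l = c :: cs then 1 else 0) * F (a :: l)
        = F (single :: c :: cs) := by
      rw [tsum_eq_single single (fun a ha => by simp [ha]), tsum_eq_single (c :: cs)]
      · simp
      · intro l hl; simp [hl]
    have h2 : ∑' a, ∑' l, (if c = a then insertions cs l else 0) * F (a :: l)
        = (cs.length + 1 : ℕ) * F (single :: c :: cs) := by
      rw [tsum_eq_single c (fun a ha => by simp [ha.symm])]
      simp only [if_true]
      rw [ih (F := fun l => F (c :: l)) fun _ _ h => hF _ _ (h.cons c)]
      rw [hF _ _ (.perm (.swap _ _ _))]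
    rw [h1, h2]
    push_cast [List.length_cons]
    ring

/-- For invariant functions the place of a new leaf is irrelevant, so the growth of the chain may be
replaced by the reversible kernel `attach`. -/
lemma sum_grown_eq_tsum {f : RTree → ℝ≥0∞} (hf : Invariant Sim f) (x : RTree) :
    (x.grown.map f).sum = ∑' y, attach x y * f y := by
  classical
  induction x using induction_on generalizing f with
  | h cs ih =>
    have hforest : ∀ F : List RTree → ℝ≥0∞, (∀ cs ds, Sim (node cs) (node ds) → F cs = F ds) →
        ((forestGrown cs).map F).sum = ∑' ds, forestAttach cs ds * F ds := by
      induction cs with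
      | nil => simp [forestGrown, forestAttach]
      | cons c cs ihc =>
        intro F hF
        rw [tsum_list]
        simp only [forestAttach, zero_mul, zero_add, add_mul, ENNReal.tsum_add]
        have h1 : ∑' a, ∑' l, (if cs = l then attach c a else 0) * F (a :: l)
            = (c.grown.map fun t => F (t :: cs)).sum := by
          rw [ih c List.mem_cons_self (f := fun t => F (t :: cs))
            fun x y h => hF _ _ (.congr [] cs h)]
          refine tsum_congr fun a => ?_
          rw [tsum_eq_single cs (fun l hl => by simp [hl.symm])]
          simp
        have h2 : ∑' a, ∑' l, (if c = a then forestAttach cs l else 0) * F (a :: l)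
            = ((forestGrown cs).map fun ts => F (c :: ts)).sum := by
          rw [ihc (fun c hc => ih c (List.mem_cons_of_mem _ hc)) (fun ts => F (c :: ts))
            fun _ _ h => hF _ _ (h.cons c)]
          rw [tsum_eq_single c (fun a ha => by simp [ha.symm])]
          simp
        rw [h1, h2]
        simp [forestGrown, Function.comp_def]
    have hF : ∀ cs ds, Sim (node cs) (node ds) → f (node cs) = f (node ds) :=
      fun _ _ h => hf _ _ h
    rw [tsum_node]
    simp only [grown, List.map_cons, List.sum_cons, List.map_map, attach, add_mul,
      ENNReal.tsum_add]
    congr 1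
    · rw [tsum_congr fun ds => mul_right_comm (insertions cs ds) _ (f (node ds)), ENNReal.tsum_mul_right,
        tsum_insertions (F := fun l => f (node l)) hF, mul_right_comm,
        ENNReal.mul_inv_cancel (by simp) (by simp), one_mul]
    · exact hforest _ hF

end RTree

/-! ### Sums over lists of a given length -/

section ListSums

variable {α : Type*}

lemma tsum_list_length_zero (G : List α → ℝ≥0∞) :
    ∑' l : List α, (if l.length = 0 then G l else 0) = G [] := by
  rw [tsum_eq_single [] (fun l hl => by simp [hl])]
  simp

lemma tsum_list_length_succ (G : List α → ℝ≥0∞) (n : ℕ) :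
    ∑' l : List α, (if l.length = n + 1 then G l else 0)
      = ∑' a, ∑' l : List α, if l.length = n then G (a :: l) else 0 := by
  rw [tsum_list]
  simp

lemma tsum_list_eq_tsum_length (G : List α → ℝ≥0∞) :
    ∑' l, G l = ∑' n, ∑' l : List α, if l.length = n then G l else 0 := by
  rw [ENNReal.tsum_comm]
  refine tsum_congr fun l => ?_
  rw [tsum_eq_single l.length (fun n hn => by simp [hn.symm])]
  simp

lemma tsum_list_append (G : List α → ℝ≥0∞) (j m : ℕ) :
    ∑' l : List α, (if l.length = j then
        ∑' l' : List α, if l'.length = m then G (l ++ l') else 0 else 0)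
      = ∑' l : List α, if l.length = j + m then G l else 0 := by
  induction j generalizing G with
  | zero =>
    rw [tsum_list_length_zero fun l : List α => ∑' l' : List α,
      if l'.length = m then G (l ++ l') else 0]
    simp
  | succ j ih =>
    rw [tsum_list_length_succ fun l : List α => ∑' l' : List α,
      if l'.length = m then G (l ++ l') else 0, show j + 1 + m = j + m + 1 by ring,
      tsum_list_length_succ]
    exact tsum_congr fun a => ih fun l => G (a :: l)

lemma tsum_list_prod (h : α → ℝ≥0∞) (n : ℕ) :
    ∑' l : List α, (if l.length = n then (l.map h).prod else 0) = (∑' a, h a) ^ n := by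
  induction n with
  | zero => rw [tsum_list_length_zero fun l => (l.map h).prod]; simp
  | succ n ih =>
    rw [tsum_list_length_succ fun l => (l.map h).prod, pow_succ', ← ENNReal.tsum_mul_right]
    refine tsum_congr fun a => ?_
    rw [← ih, ← ENNReal.tsum_mul_left]
    exact tsum_congr fun l => by simp [mul_ite]

/-- The product rule: each of the `n` positions may carry the factor `v`. At `n = 0` the truncated
exponent is harmless because of the factor `n`. -/
lemma tsum_list_prod_mul_sum (h v : α → ℝ≥0∞) (n : ℕ) :
    ∑' l : List α, (if l.length = n then (l.map h).prod * (l.map v).sum else 0)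
      = n * ((∑' a, h a * v a) * (∑' a, h a) ^ (n - 1)) := by
  induction n with
  | zero => rw [tsum_list_length_zero fun l => (l.map h).prod * (l.map v).sum]; simp
  | succ n ih =>
    rw [tsum_list_length_succ fun l => (l.map h).prod * (l.map v).sum]
    have h1 : ∀ a, ∑' l : List α, (if l.length = n then
        ((a :: l).map h).prod * ((a :: l).map v).sum else 0) =
          h a * v a * (∑' a, h a) ^ n +
            h a * (n * ((∑' a, h a * v a) * (∑' a, h a) ^ (n - 1))) := by
      intro a
      rw [← ih, ← tsum_list_prod, ← ENNReal.tsum_mul_left, ← ENNReal.tsum_mul_left,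
        ← ENNReal.tsum_add]
      refine tsum_congr fun l => ?_
      split_ifs
      · simp only [List.map_cons, List.prod_cons, List.sum_cons]; ring
      · simp
    simp_rw [h1]
    rw [ENNReal.tsum_add, ENNReal.tsum_mul_right, ENNReal.tsum_mul_right]
    rcases n with _ | n
    · simp
    · simp only [Nat.add_sub_cancel, pow_succ]
      push_cast
      ring

end ListSums

/-- The exponential series. -/
noncomputable def expSum (z : ℝ≥0∞) : ℝ≥0∞ := ∑' n : ℕ, (n.factorial : ℝ≥0∞)⁻¹ * z ^ n

lemma expSum_mono {y z : ℝ≥0∞} (h : y ≤ z) : expSum y ≤ expSum z :=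
  ENNReal.tsum_le_tsum fun n => by gcongr

lemma expSum_ofReal {x : ℝ} (hx : 0 ≤ x) :
    expSum (ENNReal.ofReal x) = ENNReal.ofReal (Real.exp x) := by
  have hs : HasSum (fun n : ℕ => (n.factorial : ℝ)⁻¹ * x ^ n) (Real.exp x) := by
    have := NormedSpace.expSeries_div_hasSum_exp (𝔸 := ℝ) x
    rw [← Real.exp_eq_exp_ℝ] at this
    simpa [div_eq_inv_mul] using this
  rw [← hs.tsum_eq, ENNReal.ofReal_tsum_of_nonneg (fun n => by positivity) hs.summable]
  refine tsum_congr fun n => ?_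
  rw [ENNReal.ofReal_mul (by positivity), ENNReal.ofReal_pow hx,
    ENNReal.ofReal_inv_of_pos (by positivity), ENNReal.ofReal_natCast]

/-- The exponential series is its own derivative. -/
lemma tsum_inv_factorial_mul (z : ℝ≥0∞) :
    ∑' n : ℕ, (n.factorial : ℝ≥0∞)⁻¹ * (n * z ^ (n - 1)) = expSum z := by
  rw [tsum_eq_zero_add' ENNReal.summable]
  simp only [Nat.cast_zero, zero_mul, mul_zero, zero_add, Nat.add_sub_cancel]
  refine tsum_congr fun n => ?_
  rw [Nat.factorial_succ, Nat.cast_mul, ENNReal.mul_inv (by simp) (by simp), ← mul_assoc,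
    mul_right_comm _ _ ((n + 1 : ℕ) : ℝ≥0∞), ENNReal.inv_mul_cancel (by simp) (by simp), one_mul]

lemma ENNReal.tsum_le_of_forall_truncation {α : Type*} (v : α → ℕ) (f : α → ℝ≥0∞) {b : ℝ≥0∞}
    (h : ∀ n, ∑' x, (if v x ≤ n then f x else 0) ≤ b) : ∑' x, f x ≤ b := by
  rw [ENNReal.tsum_eq_iSup_sum]
  refine iSup_le fun s => le_trans ?_ (h (s.sup v))
  refine le_trans (Finset.sum_le_sum fun x hx => ?_) (ENNReal.sum_le_tsum s)
  rw [if_pos (Finset.le_sup hx)]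

namespace RTree

/-! ### The total weight and the mean volume -/

variable {ρ : ℝ≥0∞}

lemma forestWeight_eq_prod (cs : List RTree) : forestWeight ρ cs = (cs.map (weight ρ)).prod := by
  induction cs with
  | nil => rfl
  | cons c cs ih => simp [forestWeight, ih]

lemma forestVolume_eq_sum (cs : List RTree) : forestVolume cs = (cs.map volume).sum := by
  induction cs with
  | nil => rfl
  | cons c cs ih => simp [forestVolume, ih]

lemma forestWeight_append (cs ds : List RTree) :
    forestWeight ρ (cs ++ ds) = forestWeight ρ cs * forestWeight ρ ds := by
  simp [forestWeight_eq_prod]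

/-- The sum of the weights of all trees. -/
noncomputable def totalWeight (ρ : ℝ≥0∞) : ℝ≥0∞ := ∑' t, weight ρ t

lemma tsum_node_prod (h : RTree → ℝ≥0∞) :
    ∑' cs : List RTree, ρ * (cs.length.factorial : ℝ≥0∞)⁻¹ * (cs.map h).prod
      = ρ * expSum (∑' t, h t) := by
  rw [tsum_list_eq_tsum_length, expSum, ← ENNReal.tsum_mul_left]
  refine tsum_congr fun n => ?_
  rw [← tsum_list_prod, ← mul_assoc, ← ENNReal.tsum_mul_left]
  refine tsum_congr fun l => ?_
  split_ifs with hl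
  · rw [hl]
  · simp

lemma tsum_node_prod_mul_sum (h v : RTree → ℝ≥0∞) :
    ∑' cs : List RTree, ρ * (cs.length.factorial : ℝ≥0∞)⁻¹ * ((cs.map h).prod * (cs.map v).sum)
      = ρ * expSum (∑' t, h t) * ∑' t, h t * v t := by
  rw [tsum_list_eq_tsum_length, ← tsum_inv_factorial_mul, mul_comm _ (∑' t, h t * v t),
    ← mul_assoc, ← ENNReal.tsum_mul_left]
  refine tsum_congr fun n => ?_
  calc _ = ρ * (n.factorial : ℝ≥0∞)⁻¹ *
        ∑' l : List RTree, (if l.length = n then (l.map h).prod * (l.map v).sum else 0) := by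
        rw [← ENNReal.tsum_mul_left]
        refine tsum_congr fun l => ?_
        split_ifs with hl
        · rw [hl]
        · simp
    _ = _ := by rw [tsum_list_prod_mul_sum]; ring

lemma totalWeight_eq : totalWeight ρ = ρ * expSum (totalWeight ρ) := by
  conv_lhs => rw [totalWeight, tsum_node]
  simp only [weight, forestWeight_eq_prod]
  exact tsum_node_prod _

/-- Sums truncated at volume `n` stay below `b` by induction: the subtrees at the root of a tree of
volume at most `n + 1` have volume at most `n`. -/
lemma totalWeight_le {b : ℝ≥0∞} (hb : ρ * expSum b ≤ b) : totalWeight ρ ≤ b := by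
  refine ENNReal.tsum_le_of_forall_truncation volume _ fun n => ?_
  induction n with
  | zero =>
    have : ∀ t : RTree, ¬ t.volume ≤ 0 := fun t => (volume_pos t).not_ge
    simp [this]
  | succ n ih =>
    refine le_trans ?_ ((mul_le_mul_right (expSum_mono ih) ρ).trans hb)
    rw [tsum_node, ← tsum_node_prod]
    refine ENNReal.tsum_le_tsum fun cs => ?_
    split_ifs with hcs
    · rw [weight, forestWeight_eq_prod]
      refine mul_le_mul_right (le_of_eq ?_) _
      congr 1
      refine List.map_congr_left fun c hc => ?_
      rw [if_pos]
      have h1 : c.volume ≤ (cs.map volume).sum :=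
        List.single_le_sum (by simp) _ (List.mem_map_of_mem hc)
      rw [volume, forestVolume_eq_sum] at hcs
      omega
    · exact zero_le

lemma weight_ne_zero (hρ : ρ ≠ 0) (t : RTree) : weight ρ t ≠ 0 := by
  induction t using induction_on with
  | h cs ih =>
    rw [weight, forestWeight_eq_prod]
    refine mul_ne_zero (mul_ne_zero hρ (ENNReal.inv_ne_zero.2 (ENNReal.natCast_ne_top _))) ?_
    rw [ne_eq, List.prod_eq_zero_iff, List.mem_map]
    rintro ⟨c, hc, h0⟩
    exact ih c hc h0

lemma totalWeight_ne_zero (hρ : ρ ≠ 0) : totalWeight ρ ≠ 0 := fun h =>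
  weight_ne_zero hρ single (ENNReal.tsum_eq_zero.1 h single)

/-- The product rule at the root, with `ρ * expSum Z` replaced by `Z`. -/
lemma tsum_weight_mul_one_add (v : RTree → ℝ≥0∞) :
    ∑' cs, weight ρ (node cs) * (1 + (cs.map v).sum)
      = totalWeight ρ + totalWeight ρ * ∑' t, weight ρ t * v t := by
  simp only [mul_add, ENNReal.tsum_add, mul_one]
  congr 1
  · rw [totalWeight, tsum_node]
  · rw [totalWeight_eq]
    rw [totalWeight, ← tsum_node_prod_mul_sum]
    refine tsum_congr fun cs => ?_
    rw [weight, forestWeight_eq_prod, mul_assoc]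

lemma cast_volume_node (cs : List RTree) :
    ((node cs).volume : ℝ≥0∞) = 1 + (cs.map fun c => (c.volume : ℝ≥0∞)).sum := by
  rw [volume, forestVolume_eq_sum]
  push_cast [List.map_map]
  rfl

lemma tsum_weight_mul_volume (h1 : totalWeight ρ ≤ 1) :
    ∑' t, weight ρ t * (t.volume : ℝ≥0∞) = totalWeight ρ * (1 - totalWeight ρ)⁻¹ := by
  set Z := totalWeight ρ with hZ
  set M := ∑' t, weight ρ t * (t.volume : ℝ≥0∞) with hM
  have hrec : M = Z + Z * M := by
    conv_lhs => rw [hM, tsum_node]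
    simp only [cast_volume_node]
    exact tsum_weight_mul_one_add _
  have hZtop : Z ≠ ∞ := ne_top_of_le_ne_top ENNReal.one_ne_top h1
  rcases h1.eq_or_lt with h1 | h1
  · rw [h1, one_mul] at hrec
    have : M = ∞ := by
      by_contra hfin
      have := (ENNReal.add_left_inj hfin).1 ((zero_add M).trans hrec)
      exact zero_ne_one this
    rw [this, h1]
    simp
  · have hpos : 1 - Z ≠ 0 := (tsub_pos_of_lt h1).ne'
    have htop : 1 - Z ≠ ∞ := ENNReal.sub_ne_top ENNReal.one_ne_top
    have hinv : 1 + Z * (1 - Z)⁻¹ = (1 - Z)⁻¹ := by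
      calc 1 + Z * (1 - Z)⁻¹ = (1 - Z) * (1 - Z)⁻¹ + Z * (1 - Z)⁻¹ := by
            rw [ENNReal.mul_inv_cancel hpos htop]
        _ = _ := by rw [← add_mul, tsub_add_cancel_of_le h1.le, one_mul]
    -- The recursion `M = Z + Z * M` is also solved by `∞`; a bound on the truncated sums rules this
    -- out.
    have hle : M ≤ Z * (1 - Z)⁻¹ := by
      refine ENNReal.tsum_le_of_forall_truncation volume _ fun n => ?_
      induction n with
      | zero =>
        have : ∀ t : RTree, ¬ t.volume ≤ 0 := fun t => (volume_pos t).not_ge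
        simp [this]
      | succ n ih =>
        have h2 : Z + Z * (Z * (1 - Z)⁻¹) = Z * (1 - Z)⁻¹ := by
          conv_rhs => rw [← hinv]
          ring
        rw [← h2]
        refine le_trans ?_ (add_le_add_right (mul_le_mul_right ih Z) Z)
        have := tsum_weight_mul_one_add (ρ := ρ)
          fun t => if t.volume ≤ n then (t.volume : ℝ≥0∞) else 0
        simp only [mul_ite, mul_zero] at this
        rw [← hZ] at this
        rw [← this, tsum_node]
        refine ENNReal.tsum_le_tsum fun cs => ?_
        split_ifs with hcs
        · rw [cast_volume_node]
          refine mul_le_mul_right (le_of_eq ?_) _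
          congr 2
          refine List.map_congr_left fun c hc => ?_
          rw [if_pos]
          have h1 : c.volume ≤ (cs.map volume).sum :=
            List.single_le_sum (by simp) _ (List.mem_map_of_mem hc)
          rw [volume, forestVolume_eq_sum] at hcs
          omega
        · exact zero_le
    have hMtop : M ≠ ∞ :=
      ne_top_of_le_ne_top (ENNReal.mul_ne_top hZtop (ENNReal.inv_ne_top.2 hpos)) hle
    have h3 : M * (1 - Z) = Z := by
      refine (ENNReal.add_left_inj (ENNReal.mul_ne_top hZtop hMtop)).1 ?_
      rw [← hrec, mul_comm Z M, ← mul_add, tsub_add_cancel_of_le h1.le, mul_one]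
    rw [← ENNReal.div_eq_inv_mul.trans (mul_comm _ _), ENNReal.eq_div_iff hpos htop, mul_comm, h3]

/-! ### The total weight of the trees of a given volume -/

/-- The total weight of the lists of `m` trees with `k` vertices. -/
noncomputable def forestMass (ρ : ℝ≥0∞) (m k : ℕ) : ℝ≥0∞ :=
  ∑' l : List RTree,
    if l.length = m then (if forestVolume l = k then forestWeight ρ l else 0) else 0

lemma forestMass_zero (k : ℕ) : forestMass ρ 0 k = if k = 0 then 1 else 0 := by
  rw [forestMass, tsum_list_length_zero fun l => if forestVolume l = k then forestWeight ρ l else 0]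
  simp [forestVolume, forestWeight, eq_comm]

lemma forestMass_one (k : ℕ) :
    forestMass ρ 1 k = ∑' t : RTree, if t.volume = k then weight ρ t else 0 := by
  rw [forestMass, tsum_list_length_succ fun l =>
    if forestVolume l = k then forestWeight ρ l else 0]
  refine tsum_congr fun t => ?_
  rw [tsum_list_length_zero fun l =>
    if forestVolume (t :: l) = k then forestWeight ρ (t :: l) else 0]
  simp [forestVolume, forestWeight]

lemma forestMass_succ_zero (m : ℕ) : forestMass ρ (m + 1) 0 = 0 := by
  rw [forestMass, tsum_list_length_succ fun l =>
    if forestVolume l = 0 then forestWeight ρ l else 0]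
  have : ∀ t l, forestVolume (t :: l) ≠ 0 := fun t l => by
    have := volume_pos t
    simp only [forestVolume]; omega
  simp [this]

/-- Remove the root of the first tree: its `j` subtrees join the other `m` trees, at the cost of the
factor `ρ / j!`. -/
lemma forestMass_succ (m k : ℕ) :
    forestMass ρ (m + 1) (k + 1)
      = ρ * ∑' j : ℕ, (j.factorial : ℝ≥0∞)⁻¹ * forestMass ρ (j + m) k := by
  rw [forestMass, tsum_list_length_succ fun l =>
    if forestVolume l = k + 1 then forestWeight ρ l else 0, tsum_node, tsum_list_eq_tsum_length,
    ← ENNReal.tsum_mul_left]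
  refine tsum_congr fun j => ?_
  rw [forestMass, ← tsum_list_append, ← mul_assoc, ← ENNReal.tsum_mul_left]
  refine tsum_congr fun ds => ?_
  split_ifs with hds
  · rw [← ENNReal.tsum_mul_left]
    refine tsum_congr fun l => ?_
    have : forestVolume (node ds :: l) = k + 1 ↔ forestVolume (ds ++ l) = k := by
      simp only [forestVolume, volume, forestVolume_append]; omega
    simp only [this, forestWeight, forestWeight_append, weight, hds, mul_ite, mul_zero, mul_assoc]
  · simp

lemma sum_pow_mul_choose (N : ℕ) (x : ℝ) :
    ∑ j ∈ Finset.range (N + 1), x ^ (N - j) * (N.choose j : ℝ) = (1 + x) ^ N := by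
  rw [add_pow]
  simp

lemma sum_mul_pow_mul_choose (N : ℕ) (x : ℝ) :
    (1 + x) * ∑ j ∈ Finset.range (N + 1), (j : ℝ) * (x ^ (N - j) * N.choose j)
      = N * (1 + x) ^ N := by
  rcases N with _ | n
  · simp
  · rw [Finset.sum_range_succ', Nat.cast_zero, zero_mul, add_zero, pow_succ,
      ← sum_pow_mul_choose n x, Finset.mul_sum, Finset.sum_mul, Finset.mul_sum]
    refine Finset.sum_congr rfl fun j _ => ?_
    have := congrArg (Nat.cast (R := ℝ)) (Nat.add_one_mul_choose_eq n j)
    push_cast at this ⊢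
    linear_combination -(1 + x) * x ^ (n - j) * this

/-- The hypothesis on `x` enters through `N + m * (1 + x) = x * (m + 1)`. -/
lemma sum_add_mul_pow_mul_choose (m N : ℕ) (x : ℝ) (hx : x = m + N) :
    (1 + x) * ∑ j ∈ Finset.range (N + 1), (j + m : ℝ) * (x ^ (N - j) * N.choose j)
      = x * (m + 1) * (1 + x) ^ N := by
  have hsum : ∑ j ∈ Finset.range (N + 1), (j + m : ℝ) * (x ^ (N - j) * N.choose j)
      = ∑ j ∈ Finset.range (N + 1), (j : ℝ) * (x ^ (N - j) * N.choose j) + m * (1 + x) ^ N := by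
    rw [← sum_pow_mul_choose, Finset.mul_sum, ← Finset.sum_add_distrib]
    exact Finset.sum_congr rfl fun j _ => by ring
  rw [hsum, mul_add, sum_mul_pow_mul_choose, hx]
  ring

/-- The number `m` of trees is arbitrary because removing a root changes it; for `m = 1` this is
Cayley's `k ^ (k - 1)` rooted labelled trees over `k!`. The guard is needed since the exponent is a
truncated difference. -/
lemma forestMass_eq {ρ : ℝ} (hρ : 0 ≤ ρ) (k m : ℕ) :
    forestMass (ENNReal.ofReal ρ) m (k + 1) = if m ≤ k + 1 then ENNReal.ofReal
      (ρ ^ (k + 1) * (m / (k + 1 : ℕ) * (k + 1 : ℕ) ^ (k + 1 - m) / (k + 1 - m).factorial))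
        else 0 := by
  induction k generalizing m with
  | zero =>
    rcases m with _ | m
    · simp [forestMass_zero]
    · have h0 : ∀ n, forestMass (ENNReal.ofReal ρ) n 0 = if n = 0 then 1 else 0 := by
        rintro (_ | n)
        · simp [forestMass_zero]
        · simp [forestMass_succ_zero]
      rw [forestMass_succ]
      rcases m with _ | m
      · rw [tsum_eq_single 0 (fun j hj => by simp [h0, hj])]
        simp [h0]
      · simp [h0]
  | succ k ih =>
    rcases m with _ | m
    · simp [forestMass_zero]
    · rw [forestMass_succ]
      simp_rw [ih]
      split_ifs with hm
      -- `N` is the largest possible number of children of the removed root; beyond it the guard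
      -- makes the terms vanish.
      · obtain ⟨N, hN⟩ : ∃ N, k + 1 = m + N := ⟨k + 1 - m, by omega⟩
        have hx0 : ((k + 1 : ℕ) : ℝ) ≠ 0 := by positivity
        rw [tsum_eq_sum (s := Finset.range (N + 1)) fun j hj => by
          rw [if_neg (by simp at hj; omega), mul_zero]]
        have hterm : ∀ j ∈ Finset.range (N + 1), (j.factorial : ℝ≥0∞)⁻¹ *
            (if j + m ≤ k + 1 then ENNReal.ofReal (ρ ^ (k + 1) * ((j + m : ℕ) / (k + 1 : ℕ) *
              (k + 1 : ℕ) ^ (k + 1 - (j + m)) / (k + 1 - (j + m)).factorial)) else 0)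
            = ENNReal.ofReal (ρ ^ (k + 1) / ((k + 1 : ℕ) * N.factorial) *
                ((j + m) * ((k + 1 : ℕ) ^ (N - j) * N.choose j))) := by
          intro j hj
          have hj' : j ≤ N := by simp at hj; omega
          rw [if_pos (by omega), show k + 1 - (j + m) = N - j by omega,
            ← ENNReal.ofReal_natCast, ← ENNReal.ofReal_inv_of_pos (by positivity),
            ← ENNReal.ofReal_mul (by positivity)]
          congr 1
          have hc := congrArg (Nat.cast (R := ℝ)) (Nat.choose_mul_factorial_mul_factorial hj')
          have hN0 : (N.factorial : ℝ) ≠ 0 := by positivity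
          have hj0 : (j.factorial : ℝ) ≠ 0 := by positivity
          have hNj0 : ((N - j).factorial : ℝ) ≠ 0 := by positivity
          rw [Nat.cast_mul, Nat.cast_mul] at hc
          rw [← hc]
          have hch : (N.choose j : ℝ) ≠ 0 := by
            exact_mod_cast (Nat.choose_pos hj').ne'
          rw [Nat.cast_add j m]
          field_simp
        rw [Finset.sum_congr rfl hterm, ← ENNReal.ofReal_sum_of_nonneg fun j _ => by positivity,
          ← ENNReal.ofReal_mul hρ, ← Finset.mul_sum]
        congr 1
        have hkey := sum_add_mul_pow_mul_choose m N ((k + 1 : ℕ) : ℝ) (by rw [hN]; push_cast; ring)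
        set T := ∑ j ∈ Finset.range (N + 1),
          (j + m : ℝ) * (((k + 1 : ℕ) : ℝ) ^ (N - j) * N.choose j) with hT
        rw [show k + 1 + 1 - (m + 1) = N by omega,
          show ((k + 1 + 1 : ℕ) : ℝ) = 1 + ((k + 1 : ℕ) : ℝ) by push_cast; ring]
        set x : ℝ := ((k + 1 : ℕ) : ℝ) with hx
        have hx1 : 1 + x ≠ 0 := by positivity
        have hTe : T = x * (m + 1) * (1 + x) ^ N / (1 + x) := by
          rw [← hkey]; field_simp
        rw [hTe, pow_succ ρ (k + 1)]
        push_cast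
        field_simp
      · simp only [mul_ite, mul_zero]
        rw [ENNReal.tsum_eq_zero.2 fun j => if_neg (by omega), mul_zero]

/-- The total weight of the trees with `k` vertices. -/
lemma tsum_weight_volume_eq {ρ : ℝ} (hρ : 0 ≤ ρ) {k : ℕ} (hk : 1 ≤ k) :
    ∑' t : RTree, (if t.volume = k then weight (ENNReal.ofReal ρ) t else 0)
      = ENNReal.ofReal ((k : ℝ) ^ (k - 1) / k.factorial * ρ ^ k) := by
  obtain ⟨k, rfl⟩ := Nat.exists_eq_add_of_le' hk
  rw [← forestMass_one, forestMass_eq hρ, if_pos (by omega)]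
  congr 1
  rw [Nat.factorial_succ, Nat.add_sub_cancel]
  push_cast
  field_simp

end RTree

/-! ### The tree process as a jump chain -/

namespace RTree

open JumpChain

open Classical in
/-- The jump rates of the tree process. -/
noncomputable def rate (lam mu : ℝ) (x y : RTree) : ℝ≥0∞ :=
  ENNReal.ofReal lam * (x.grown.map fun z => if z = y then (1 : ℝ≥0∞) else 0).sum +
    ENNReal.ofReal mu * prunings x y

variable {lam mu : ℝ}

lemma sum_pruned_eq_tsum (f : RTree → ℝ≥0∞) (x : RTree) :
    (x.pruned.map f).sum = ∑' y, prunings x y * f y :=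
  list_sum_map_eq_tsum _ f

lemma jumpOp_rate (f : RTree → ℝ≥0∞) (x : RTree) :
    jumpOp (rate lam mu) f x = ENNReal.ofReal lam * (x.grown.map f).sum +
      ENNReal.ofReal mu * (x.pruned.map f).sum := by
  simp only [jumpOp, rate, add_mul, ENNReal.tsum_add, mul_assoc, ENNReal.tsum_mul_left]
  rw [← list_sum_map_eq_tsum, ← sum_pruned_eq_tsum]

/-- The recursion with fewer than `n` jumps is the `n`-th partial sum over the exact numbers of
jumps. -/
lemma transition_eq_prob (t : ℝ) (x y : RTree) :
    transition lam mu t x y = prob (exitRate lam mu) (rate lam mu) t x y := by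
  classical
  have h : ∀ n t x, transitionUpTo lam mu n t x y = ∑ i ∈ Finset.range n,
      jumps (exitRate lam mu) (rate lam mu) i (fun z => if z = y then 1 else 0) t x := by
    intro n
    induction n with
    | zero => intro t x; simp [transitionUpTo]
    | succ n ih =>
      intro t x
      conv_rhs => rw [Finset.sum_range_succ', add_comm]
      simp only [transitionUpTo, jumps]
      congr 1
      · by_cases hxy : x = y <;> simp [hxy, hold]
      · rw [← lintegral_finsetSum _ fun i _ => measurable_integrand i _ t x]
        refine lintegral_congr fun s => ?_
        rw [← Finset.mul_sum, ← jumpOp_sum, jumpOp_rate]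
        simp only [ih]
        rfl
  unfold transition prob semigroup
  rw [ENNReal.tsum_eq_iSup_nat]
  refine iSup_congr fun n => ?_
  rw [h]

lemma exitRate_nonneg (hlam : 0 ≤ lam) (hmu : 0 ≤ mu) (x : RTree) : 0 ≤ exitRate lam mu x := by
  unfold exitRate; positivity

lemma ofReal_exitRate (hlam : 0 ≤ lam) (hmu : 0 ≤ mu) (x : RTree) :
    ENNReal.ofReal (exitRate lam mu x)
      = ENNReal.ofReal lam * x.grown.length + ENNReal.ofReal mu * x.pruned.length := by
  rw [exitRate, ENNReal.ofReal_add (by positivity) (by positivity), ENNReal.ofReal_mul hlam,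
    ENNReal.ofReal_mul hmu, ENNReal.ofReal_natCast, ENNReal.ofReal_natCast]

lemma tsum_rate (hlam : 0 ≤ lam) (hmu : 0 ≤ mu) (x : RTree) :
    ∑' y, rate lam mu x y = ENNReal.ofReal (exitRate lam mu x) := by
  have := jumpOp_rate (lam := lam) (mu := mu) (fun _ => 1) x
  simpa [jumpOp, ofReal_exitRate hlam hmu] using this

lemma sum_map_of_forall_eq (l : List RTree) (f : RTree → ℝ≥0∞) (c : ℝ≥0∞) (h : ∀ y ∈ l, f y = c) :
    (l.map f).sum = l.length * c := by
  rw [List.map_congr_left h]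
  simp

/-- The tree process does not explode. -/
lemma conservative (hlam : 0 ≤ lam) (hmu : 0 ≤ mu) {t : ℝ} (ht : 0 ≤ t) (x : RTree) :
    semigroup (exitRate lam mu) (rate lam mu) t (fun _ => 1) x = 1 := by
  -- A growth raises `d + volume` by `2`, one for the jump and one for the vertex; a deletion leaves
  -- it unchanged. The drift is thus `2 * lam * volume`.
  refine semigroup_one (V := fun x => (x.volume : ℝ≥0∞)) (c := 2 * lam)
    (exitRate_nonneg hlam hmu) (tsum_rate hlam hmu) (by positivity)
    (fun x => ENNReal.natCast_ne_top _) (fun d x => ?_) ht x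
  rw [jumpOp_rate, ENNReal.ofReal_add (exitRate_nonneg hlam hmu x) (by positivity),
    ofReal_exitRate hlam hmu, ENNReal.ofReal_mul zero_le_two, ENNReal.ofReal_ofNat,
    sum_map_of_forall_eq x.grown _ ((d + x.volume : ℕ) + 2) fun y hy => by
      rw [volume_of_mem_grown y hy]; push_cast; ring,
    sum_map_of_forall_eq x.pruned _ (d + x.volume : ℕ) fun y hy => by
      rw [← volume_of_mem_pruned y hy]; push_cast; ring, length_grown]
  push_cast
  calc _ = (ENNReal.ofReal lam * x.volume + ENNReal.ofReal mu * x.pruned.length) *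
        (d + x.volume) + 2 * ENNReal.ofReal lam * x.volume := by ring
    _ ≤ (ENNReal.ofReal lam * x.volume + ENNReal.ofReal mu * x.pruned.length) *
        (d + x.volume) + 2 * ENNReal.ofReal lam * (d + x.volume) := by
        gcongr; exact le_add_self
    _ = _ := by ring

lemma invariant_jumpOp {f : RTree → ℝ≥0∞} (hf : Invariant Sim f) :
    Invariant Sim (jumpOp (rate lam mu) f) := fun x y h => by
  rw [jumpOp_rate, jumpOp_rate]
  exact congrArg₂ _ (congrArg _ (invariant_sum_grown hf x y h))
    (congrArg _ (invariant_sum_pruned hf x y h))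

lemma invariant_exitRate : Invariant Sim (exitRate lam mu) := fun x y h => by
  have hp := invariant_sum_pruned (f := fun _ => 1) (fun _ _ _ => rfl) x y h
  simp only [List.map_const', List.sum_replicate, nsmul_eq_mul, mul_one, Nat.cast_inj] at hp
  rw [exitRate, exitRate, length_grown, length_grown, h.volume_eq, hp]

/-- Detailed balance exchanges growth acting on one function with pruning acting on the other, so
the two halves of the generator swap roles. -/
lemma pairing_jumpOp (hmu : 0 < mu) {f g : RTree → ℝ≥0∞}
    (hf : Invariant Sim f) (hg : Invariant Sim g) :
    pairing (weight (ENNReal.ofReal (lam / mu))) g (jumpOp (rate lam mu) f)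
      = pairing (weight (ENNReal.ofReal (lam / mu))) (jumpOp (rate lam mu) g) f := by
  set ρ := ENNReal.ofReal (lam / mu) with hρ
  have hmul : ENNReal.ofReal lam = ENNReal.ofReal mu * ρ := by
    rw [hρ, ← ENNReal.ofReal_mul hmu.le, mul_div_cancel₀ _ hmu.ne']
  have key : ∀ f g : RTree → ℝ≥0∞, Invariant Sim f →
      ∑' x, weight ρ x * (g x * (ENNReal.ofReal lam * (x.grown.map f).sum))
        = ∑' x, weight ρ x * (f x * (ENNReal.ofReal mu * (x.pruned.map g).sum)) := by
    intro f g hf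
    simp_rw [sum_grown_eq_tsum hf, sum_pruned_eq_tsum, ← ENNReal.tsum_mul_left]
    rw [ENNReal.tsum_comm]
    refine tsum_congr fun y => tsum_congr fun x => ?_
    calc _ = ENNReal.ofReal mu * (ρ * (weight ρ x * attach x y)) * (g x * f y) := by
          rw [hmul]; ring
      _ = _ := by rw [detailed_balance]; ring
  rw [pairing_comm _ f]
  simp only [pairing, jumpOp_rate, mul_add, ENNReal.tsum_add]
  rw [key f g hf, key g f hg, add_comm]

/-- Deletions alone lead from every tree to the single vertex. -/
lemma connected (hmu : 0 < mu) (g : RTree → ℝ≥0∞)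
    (hg : ∀ x y, rate lam mu x y ≠ 0 → g x = g y) (x y : RTree) : g x = g y := by
  have h : ∀ n, ∀ x : RTree, x.volume = n → g x = g single := by
    intro n
    induction n with
    | zero => exact fun x hx => absurd hx (volume_pos x).ne'
    | succ n ih =>
      intro x hx
      by_cases hs : x = single
      · rw [hs]
      · obtain ⟨y, hy⟩ := List.exists_mem_of_ne_nil _ (pruned_ne_nil hs)
        rw [← ih y (by have := volume_of_mem_pruned y hy; omega)]
        refine hg x y fun h0 => ?_
        have h1 : prunings x y = 0 :=
          (mul_eq_zero.1 (add_eq_zero.1 h0).2).resolve_left (ENNReal.ofReal_pos.2 hmu).ne'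
        classical
        have h2 : (1 : ℝ≥0∞) ≤ prunings x y :=
          List.single_le_sum (fun _ _ => zero_le) _
            (List.mem_map.2 ⟨y, hy, if_pos rfl⟩)
        rw [h1] at h2
        exact absurd h2 (by simp)
  rw [h _ x rfl, h _ y rfl]

lemma isReversible (hlam : 0 < lam) (hmu : 0 < mu)
    (hfin : totalWeight (ENNReal.ofReal (lam / mu)) ≠ ∞) :
    IsReversible (exitRate lam mu) (rate lam mu) Sim (weight (ENNReal.ofReal (lam / mu))) where
  exit_nonneg := exitRate_nonneg hlam.le hmu.le
  exit_invariant := invariant_exitRate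
  jumpOp_invariant _ := invariant_jumpOp
  symmetric _ _ := pairing_jumpOp hmu
  conservative _ ht := conservative hlam.le hmu.le ht
  weight_ne_zero := weight_ne_zero (ENNReal.ofReal_pos.2 (div_pos hlam hmu)).ne'
  weight_finite := hfin
  connected := connected hmu

/-! ### The stationary law -/

/-- The law on the trees that is proportional to the weights. -/
noncomputable def gibbs (ρ : ℝ≥0∞) : Measure RTree :=
  Measure.sum fun t => ((totalWeight ρ)⁻¹ * weight ρ t) • Measure.dirac t

lemma lintegral_gibbs (ρ : ℝ≥0∞) (f : RTree → ℝ≥0∞) :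
    ∫⁻ t, f t ∂gibbs ρ = (∑' t, weight ρ t * f t) / totalWeight ρ := by
  rw [gibbs, lintegral_sum_measure, ENNReal.div_eq_inv_mul, ← ENNReal.tsum_mul_left]
  refine tsum_congr fun t => ?_
  rw [lintegral_smul_measure, lintegral_dirac' _ measurable_from_top, smul_eq_mul, mul_assoc]

lemma isProbabilityMeasure_gibbs {ρ : ℝ≥0∞} (h0 : totalWeight ρ ≠ 0) (h : totalWeight ρ ≠ ∞) :
    IsProbabilityMeasure (gibbs ρ) := ⟨by
  rw [← lintegral_one, lintegral_gibbs]
  simp only [mul_one]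
  exact ENNReal.div_self h0 h⟩

lemma measurable_volume : Measurable volume := measurable_from_top

open Classical in
lemma gibbs_map_apply (ρ : ℝ≥0∞) (A : Set ℕ) :
    (gibbs ρ).map volume A
      = (∑' t, weight ρ t * if t.volume ∈ A then 1 else 0) / totalWeight ρ := by
  rw [Measure.map_apply measurable_volume (MeasurableSet.of_discrete),
    ← lintegral_indicator_one (MeasurableSpace.measurableSet_top), lintegral_gibbs]
  rfl

open Classical in
lemma tendsto_volume (hlam : 0 < lam) (hmu : 0 < mu)
    (hfin : totalWeight (ENNReal.ofReal (lam / mu)) ≠ ∞) (A : Set ℕ) :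
    Tendsto (fun t : ℝ => ∑' T : RTree,
        transition lam mu t single T * if T.volume ∈ A then 1 else 0)
      atTop (𝓝 ((gibbs (ENNReal.ofReal (lam / mu))).map volume A)) := by
  have := (isReversible hlam hmu hfin).tendsto_semigroup
    (f := fun T => if T.volume ∈ A then 1 else 0)
    (fun x y h => by simp only [h.volume_eq]) (fun x => by split_ifs <;> simp) single
  rw [gibbs_map_apply]
  simp_rw [transition_eq_prob, ← semigroup_eq_tsum]
  exact this

end RTree

-- The law of the process at a fixed time.

namespace IsTreeProcess

open RTree

variable {lam mu : ℝ} {Ω : Type*} [MeasurableSpace Ω] {P : Measure Ω} {G : ℝ≥0 → Ω → RTree}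

/-- The Markov property for the two times `0` and `t`, with the almost sure initial state removed.
-/
lemma measure_eq [IsProbabilityMeasure P] (hG : IsTreeProcess lam mu P G) (t : ℝ≥0) (T : RTree) :
    P {ω | G t ω = T} = transition lam mu t single T := by
  have h := hG.markov 0 (fun i => if i = 0 then 0 else t) (fun i => if i = 0 then single else T)
    (fun i j hij => by
      rcases i with _ | i
      · simp
      · simp [show j ≠ 0 by omega])
  have h1 : P {ω | ∀ i ≤ 0, G (if i = 0 then 0 else t) ω = if i = 0 then single else T} = 1 := by
    rw [← measure_univ (μ := P)]
    refine measure_congr ?_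
    filter_upwards [hG.initial] with ω hω
    refine propext ⟨fun _ => trivial, fun _ i hi => ?_⟩
    obtain rfl : i = 0 := by omega
    simpa using hω
  have h2 : P {ω | ∀ i ≤ 0 + 1, G (if i = 0 then 0 else t) ω = if i = 0 then single else T}
      = P {ω | G t ω = T} := by
    refine measure_congr ?_
    filter_upwards [hG.initial] with ω hω
    refine propext ⟨fun h => (by simpa using h 1 le_rfl : G t ω = T), fun h i hi => ?_⟩
    rcases i with _ | i
    · simpa using hω
    · have h' : G t ω = T := h
      simpa using h'
  rw [h1, h2] at h
  simpa using h

open Classical in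
lemma map_volume_apply [IsProbabilityMeasure P] (hG : IsTreeProcess lam mu P G) (t : ℝ≥0)
    (A : Set ℕ) :
    P.map (fun ω => (G t ω).volume) A
      = ∑' T : RTree, transition lam mu t single T * if T.volume ∈ A then 1 else 0 := by
  rw [← Function.comp_def, ← Measure.map_map measurable_volume (hG.measurable t),
    Measure.map_apply measurable_volume (MeasurableSet.of_discrete),
    ← lintegral_indicator_one (MeasurableSpace.measurableSet_top),
    lintegral_countable']
  refine tsum_congr fun T => ?_
  rw [mul_comm, Measure.map_apply (hG.measurable t) (MeasurableSpace.measurableSet_top),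
    ← hG.measure_eq t T]
  rfl

end IsTreeProcess

-- The stationary volume.

theorem theorem3p1 (lam mu : ℝ) (hlam : 0 < lam) (hmu : 0 < mu)
    (hrho : lam / mu ≤ Real.exp (-1)) :
    -- `r` is the smallest root of `r * exp (-r) = rho`
    ∃ r : ℝ, IsLeast {x : ℝ | x * Real.exp (-x) = lam / mu} r ∧
    -- the chain does not explode, so that its law at each time is a probability on trees
    (∀ t : ℝ, 0 ≤ t → ∑' T : RTree, transition lam mu t RTree.single T = 1) ∧
    -- the law of the stationary volume `N`
    ∃ (ν : Measure ℕ) (_ : IsProbabilityMeasure ν),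
      -- the probabilities that `N(t) = k` converge
      (∀ k : ℕ, Tendsto
        (fun t : ℝ => ∑' T : {T : RTree // T.volume = k}, transition lam mu t RTree.single T)
        atTop (𝓝 (ν {k}))) ∧
      -- for every version of the process, `N(t)` converges in distribution to `N`
      (∀ {Ω : Type*} [MeasurableSpace Ω] (P : Measure Ω) [IsProbabilityMeasure P]
        (G : ℝ≥0 → Ω → RTree), IsTreeProcess lam mu P G →
          TendstoInDistribution (fun t ω => (G t ω).volume) atTop (id : ℕ → ℕ)
            (fun _ => P) ν) ∧
      (∀ k : ℕ, 1 ≤ k → ν {k} =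
        ENNReal.ofReal (1 / r * ((k : ℝ) ^ (k - 1) / (k.factorial : ℝ)) * (lam / mu) ^ k)) ∧
      -- the mean of `N`, which is infinite when `r = 1`
      ∫⁻ n : ℕ, (n : ℝ≥0∞) ∂ν = (ENNReal.ofReal (1 - r))⁻¹ := by
  classical
  have hρ : 0 < lam / mu := div_pos hlam hmu
  set Z := RTree.totalWeight (ENNReal.ofReal (lam / mu)) with hZ
  have hsuper : ∀ x : ℝ, 0 ≤ x → lam / mu * Real.exp x ≤ x → Z ≤ ENNReal.ofReal x :=
    fun x hx h => RTree.totalWeight_le (by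
      rw [expSum_ofReal hx, ← ENNReal.ofReal_mul hρ.le]
      exact ENNReal.ofReal_le_ofReal h)
  -- The assumption on `lam / mu` says exactly that `x = 1` is a supersolution.
  have hZ1 : Z ≤ 1 := by
    refine (hsuper 1 zero_le_one ?_).trans ENNReal.ofReal_one.le
    calc lam / mu * Real.exp 1 ≤ Real.exp (-1) * Real.exp 1 := by gcongr
      _ = 1 := by rw [← Real.exp_add]; simp
  have hZtop : Z ≠ ∞ := ne_top_of_le_ne_top ENNReal.one_ne_top hZ1
  have hZ0 : Z ≠ 0 := RTree.totalWeight_ne_zero (ENNReal.ofReal_pos.2 hρ).ne'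
  have hr : ENNReal.ofReal Z.toReal = Z := ENNReal.ofReal_toReal hZtop
  have hr0 : 0 < Z.toReal := ENNReal.toReal_pos hZ0 hZtop
  have hroot : Z.toReal = lam / mu * Real.exp Z.toReal := by
    have h := congrArg ENNReal.toReal (RTree.totalWeight_eq (ρ := ENNReal.ofReal (lam / mu)))
    rw [← hZ, ← hr, expSum_ofReal hr0.le, ← ENNReal.ofReal_mul hρ.le,
      ENNReal.toReal_ofReal hr0.le, ENNReal.toReal_ofReal (by positivity)] at h
    exact h
  have hν : IsProbabilityMeasure
      ((RTree.gibbs (ENNReal.ofReal (lam / mu))).map RTree.volume) := by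
    have := RTree.isProbabilityMeasure_gibbs hZ0 hZtop
    exact Measure.isProbabilityMeasure_map RTree.measurable_volume.aemeasurable
  refine ⟨Z.toReal, ⟨?_, ?_⟩, ?_, _, hν, ?_, ?_, ?_, ?_⟩
  · simp only [Set.mem_ofPred_eq]
    nth_rw 1 [hroot]
    rw [mul_assoc, ← Real.exp_add]
    simp
  · intro x hx
    simp only [Set.mem_ofPred_eq] at hx
    have hx0 : 0 < x := by
      by_contra hneg
      have := mul_nonpos_of_nonpos_of_nonneg (not_lt.1 hneg) (Real.exp_pos (-x)).le
      linarith
    -- Every root is a supersolution, so it dominates `Z`.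
    refine ENNReal.toReal_le_of_le_ofReal hx0.le (hsuper x hx0.le ?_)
    rw [← hx, mul_assoc, ← Real.exp_add]
    simp
  · intro t ht
    have h := RTree.conservative hlam.le hmu.le ht RTree.single
    rw [JumpChain.semigroup_eq_tsum] at h
    simpa [RTree.transition_eq_prob] using h
  · intro k
    refine (RTree.tendsto_volume hlam hmu hZtop {k}).congr fun t => ?_
    refine Eq.trans ?_
      (tsum_subtype {T : RTree | T.volume = k} (transition lam mu t RTree.single)).symm
    exact tsum_congr fun T => by simp [Set.indicator]
  · intro Ω _ P _ G hG
    have hmeas : ∀ t, Measurable fun ω => (G t ω).volume := fun t =>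
      RTree.measurable_volume.comp (hG.measurable t)
    refine ⟨fun t => (hmeas t).aemeasurable, aemeasurable_id, ?_⟩
    -- In the portmanteau criterion the limit exists for every set of volumes, so the inequality is
    -- an equality.
    refine tendsto_of_forall_isOpen_le_liminf' fun A _ => ?_
    have h := (RTree.tendsto_volume hlam hmu hZtop A).comp (NNReal.tendsto_coe_atTop.2 tendsto_id)
    refine le_of_eq ?_
    simp only [ProbabilityMeasure.coe_mk, Measure.map_id, hG.map_volume_apply]
    exact h.liminf_eq.symm
  · intro k hk
    rw [RTree.gibbs_map_apply]
    simp only [Set.mem_singleton_iff, mul_ite, mul_one, mul_zero]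
    rw [RTree.tsum_weight_volume_eq hρ.le hk, ← hZ, ← hr, ← ENNReal.ofReal_div_of_pos hr0]
    rw [ENNReal.toReal_ofReal hr0.le]
    congr 1
    ring
  · rw [lintegral_map (measurable_from_top) RTree.measurable_volume, RTree.lintegral_gibbs,
      RTree.tsum_weight_mul_volume hZ1, ← hZ, mul_comm, ENNReal.mul_div_cancel_right hZ0 hZtop,
      ENNReal.ofReal_sub _ hr0.le, hr, ENNReal.ofReal_one]
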